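/- For $\sigma>0$ let $T(\sigma^{-1})$ be the set of functions $f=g_{\sigma^{-1}}*\mu$ on $\mathbb{R}$, where $g_{\sigma^{-1}}(x)=\sigma^{-1/2}e^{-\pi x^2/\sigma}$ and $\mu$ is a positive finite Borel measure on $\mathbb{R}$ with non-zero mass. For $\mathbf{c}=(c_0,c_1,c_2)\in\mathbb{R}^3$, $\sigma_0,\sigma_1,\sigma_2>0$ and $\mathbf{G}=(\sigma_0^{-1},\sigma_1^{-1},\sigma_2^{-1})$, let $\mathrm{F}(\mathbf{B},\mathbf{c},\mathbf{G})$ and $\mathrm{I}(\mathbf{B},\mathbf{c},\mathbf{G})$ be respectively the supremum and the infimum, in $[0,\infty]$, of $$\frac{\int_{\mathbb{R}^2} f_0(x)^{c_0}f_1(y)^{c_1}f_2(x-y)^{c_2}\,dx\,dy}{\left(\int_{\mathbb{R}} f_0\right)^{c_0}\left(\int_{\mathbb{R}} f_1\right)^{c_1}\left(\int_{\mathbb{R}} f_2\right)^{c_2}}$$ over all $f_j\in T(\sigma_j^{-1})$, $j=0,1,2$; here $\mathbf{B}=(B_0,B_1,B_2)$ with $B_0(x,y)=x$, $B_1(x,y)=y$,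 $B_2(x,y)=x-y$. For $c,\sigma>0$ write $\widetilde{A}_{c,\sigma}=\left(\sigma^{1-c}/c\right)^{1/2}$. Let $c_0<1$ and $c_1,c_2>0$, and suppose that $\sigma_0,\sigma_1,\sigma_2>0$ satisfy $$\frac{\sigma_0}{1-c_0}=\frac{\sigma_1}{c_1}+\frac{\sigma_2}{c_2}.$$ (1) If $c_0,c_1,c_2\in(0,1)$, then $$\mathrm{F}(\mathbf{B},\mathbf{c},\mathbf{G})=\frac{\widetilde{A}_{c_1,\sigma_1}\widetilde{A}_{c_2,\sigma_2}}{\widetilde{A}_{1-c_0,\sigma_0}}$$ holds if and only if $$\frac{c_0(1-c_0)}{\sigma_0}\ge\max\left\{\frac{c_1(1-c_1)}{\sigma_1},\frac{c_2(1-c_2)}{\sigma_2}\right\}.$$ (2) If $c_0<0$ and $c_1,c_2\in[1,\infty)$, then $$\mathrm{I}(\mathbf{B},\mathbf{c},\mathbf{G})=\frac{\widetilde{A}_{c_1,\sigma_1}\widetilde{A}_{c_2,\sigma_2}}{\widetilde{A}_{1-c_0,\sigma_0}}$$ holds if and only if $$\frac{c_0(1-c_0)}{\sigma_0}\le\min\left\{\frac{c_1(1-c_1)}{\sigma_1},\frac{c_2(1-c_2)}{\sigma_2}\right\}.$$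 -/

import Mathlib

open MeasureTheory
open scoped ENNReal RealInnerProductSpace

noncomputable section

namespace BrascampLieb

/-- The normalized centred gaussian `g_A(x) = (det A)^{1/2} exp(-π ⟨x, A x⟩)` on a Euclidean
space `E`, for a (positive definite) linear map `A` of `E`. -/
def gaussian {E : Type*} [NormedAddCommGroup E] [InnerProductSpace ℝ E]
    (A : E →ₗ[ℝ] E) (x : E) : ℝ :=
  (LinearMap.det A) ^ (1 / 2 : ℝ) * Real.exp (-Real.pi * ⟪x, A x⟫)

/-- The convolution `g_A * μ` of the gaussian `g_A` with a measure `μ`, with values in `[0, ∞]`. -/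
def gaussianConv {E : Type*} [NormedAddCommGroup E] [InnerProductSpace ℝ E] [MeasurableSpace E]
    (A : E →ₗ[ℝ] E) (μ : Measure E) (x : E) : ℝ≥0∞ :=
  ∫⁻ y, ENNReal.ofReal (gaussian A (x - y)) ∂μ

/-- The class `T(G)` of type `G` functions: all `g_G * μ` with `μ` a positive finite Borel measure
of non-zero mass. -/
def typeClass {E : Type*} [NormedAddCommGroup E] [InnerProductSpace ℝ E] [MeasurableSpace E]
    [BorelSpace E] (G : E →ₗ[ℝ] E) : Set (E → ℝ≥0∞) :=
  {f | ∃ μ : Measure E, IsFiniteMeasure μ ∧ μ ≠ 0 ∧ f = gaussianConv G μ}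

section Functional

variable {ι : Type*} [Fintype ι]
  {V : Type*} [AddCommGroup V] [Module ℝ V] [MeasureSpace V]
  {E : ι → Type*} [∀ j, NormedAddCommGroup (E j)] [∀ j, InnerProductSpace ℝ (E j)]
  [∀ j, MeasureSpace (E j)]

/-- The Brascamp--Lieb functional
`BL(B, c; f) = (∫ ∏ f_j(B_j x)^{c_j} dx) / ∏ (∫ f_j)^{c_j}`, with values in `[0, ∞]`. -/
def functional (B : ∀ j, V →ₗ[ℝ] E j) (c : ι → ℝ) (f : ∀ j, E j → ℝ≥0∞) : ℝ≥0∞ :=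
  (∫⁻ x : V, ∏ j, f j (B j x) ^ c j) / ∏ j, (∫⁻ y : E j, f j y) ^ c j

/-- The regularized forward constant `F(B, c, G) = sup_{f ∈ T(G)} BL(B, c; f)`. -/
def forwardConst [∀ j, BorelSpace (E j)] (B : ∀ j, V →ₗ[ℝ] E j) (c : ι → ℝ)
    (G : ∀ j, E j →ₗ[ℝ] E j) : ℝ≥0∞ :=
  ⨆ (f : ∀ j, E j → ℝ≥0∞) (_ : ∀ j, f j ∈ typeClass (G j)), functional B c f

/-- The regularized inverse constant `I(B, c, G) = inf_{f ∈ T(G)} BL(B, c; f)`. -/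
def inverseConst [∀ j, BorelSpace (E j)] (B : ∀ j, V →ₗ[ℝ] E j) (c : ι → ℝ)
    (G : ∀ j, E j →ₗ[ℝ] E j) : ℝ≥0∞ :=
  ⨅ (f : ∀ j, E j → ℝ≥0∞) (_ : ∀ j, f j ∈ typeClass (G j)), functional B c f

end Functional

/-- The linear maps `ℝ² → ℝ` of the Young datum:
`B_0(x, y) = x`, `B_1(x, y) = y`, `B_2(x, y) = x - y`. -/
def youngMap : Fin 3 → (ℝ × ℝ →ₗ[ℝ] ℝ) :=
  ![LinearMap.fst ℝ ℝ ℝ, LinearMap.snd ℝ ℝ ℝ, LinearMap.fst ℝ ℝ ℝ - LinearMap.snd ℝ ℝ ℝ]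

/-- `G = (σ_0⁻¹, σ_1⁻¹, σ_2⁻¹)`, each entry acting on `ℝ` by multiplication. -/
def youngG (σ : Fin 3 → ℝ) (j : Fin 3) : ℝ →ₗ[ℝ] ℝ :=
  (σ j)⁻¹ • LinearMap.id

/-- `F(B, c, G)` for the Young datum with `G = (σ_0⁻¹, σ_1⁻¹, σ_2⁻¹)`. -/
def youngForwardConst (c σ : Fin 3 → ℝ) : ℝ≥0∞ :=
  forwardConst (E := fun _ : Fin 3 => ℝ) youngMap c (youngG σ)

/-- `I(B, c, G)` for the Young datum with `G = (σ_0⁻¹, σ_1⁻¹, σ_2⁻¹)`. -/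
def youngInverseConst (c σ : Fin 3 → ℝ) : ℝ≥0∞ :=
  inverseConst (E := fun _ : Fin 3 => ℝ) youngMap c (youngG σ)

/-- `Ã_{c,σ} = (σ^{1-c} / c)^{1/2}` for `c, σ > 0`. -/
def tildeA (c σ : ℝ) : ℝ :=
  (σ ^ (1 - c) / c) ^ (1 / 2 : ℝ)

end BrascampLieb

end

/-! Write a_j = c_j/σ_j and D = `pairSum a`, the determinant of the form a_0x² + a_1y² + a_2(x-y)².
The relation between the σ_j says exactly (1-c_0)D = a_1a_2: the functional on centred normal
densities is stationary in the variance of f_0 at σ. Under it the claimed constant is the value of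
the functional at the normal densities of variances σ_j, and the two inequalities of each case
become comparisons of (1-c_1)D with a_0a_2 and of (1-c_2)D with a_0a_1.

Necessity is a first variation. A normal density of variance t ≥ σ_j lies in the class, so the
functional at normal densities must not rise (for F) or fall (for I) as one variance grows from σ_j;
the one-sided derivatives in the variances of f_1 and f_2 give the two inequalities.

Sufficiency is a transport argument. Let T_j be the increasing map taking f_j, normalized, to the
normal law of variance σ_j. Its derivative l_j is at most 1, because the isoperimetric profile of
the normal law is concave (`exists_normalTransport`). The functional becomes a constant times the
integral of ∏ l_j^{c_j} exp(-π Σ a_j T_j²). Change variables by the gradient map Φ of Σ a_jψ_j(B_j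
p), ψ_j' = T_j, with one sign flipped. The energy Σ a_jT_j² is the dual quadratic form at Φ plus a
multiple of a square with the sign of a_0a_1a_2 (`energy_eq`), and |det DΦ| is the absolute value of
`pairSum` of a_jl_j. What remains is to compare D ∏ l_j^{c_j} with that determinant; this is
weighted AM-GM together with l_j ≤ 1.

If all c_j > 0, then Φ is injective and every estimate is an upper bound (`lintegral_transport_le`).
If c_0 < 0, the estimates reverse, and Φ must instead reach every point of the plane with a
determinant of the right sign. Minimizing a coercive potential achieves this when μ_1 and μ_2 have
bounded support (`exists_youngGrad_eq`); truncation then gives the general case. -/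

namespace BrascampLieb

open Filter Set Topology

/-! ### The normal law and its isoperimetric profile -/

/-- The centred normal density `x ↦ σ^{-1/2} exp(-π x² / σ)`. -/
noncomputable def normalDensity (σ x : ℝ) : ℝ :=
  (√σ)⁻¹ * Real.exp (-(Real.pi / σ) * x ^ 2)

/-- The distribution function of `normalDensity σ`. -/
noncomputable def normalCdf (σ t : ℝ) : ℝ :=
  1 / 2 + ∫ s in (0 : ℝ)..t, normalDensity σ s

section NormalDensity

variable {σ : ℝ}

lemma normalDensity_pos (hσ : 0 < σ) (x : ℝ) : 0 < normalDensity σ x := by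
  unfold normalDensity; positivity

@[fun_prop]
lemma continuous_normalDensity : Continuous (normalDensity σ) := by
  unfold normalDensity; fun_prop

lemma normalDensity_le (hσ : 0 < σ) (x : ℝ) : normalDensity σ x ≤ (√σ)⁻¹ := by
  unfold normalDensity
  refine mul_le_of_le_one_right (by positivity) (Real.exp_le_one_iff.2 ?_)
  have := Real.pi_pos
  have : 0 ≤ Real.pi / σ * x ^ 2 := by positivity
  linarith

lemma hasDerivAt_normalDensity (x : ℝ) :
    HasDerivAt (normalDensity σ) (-(2 * Real.pi / σ) * x * normalDensity σ x) x := by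
  unfold normalDensity
  have h : HasDerivAt (fun x : ℝ => -(Real.pi / σ) * x ^ 2) (-(Real.pi / σ) * (2 * x)) x := by
    simpa using (hasDerivAt_pow 2 x).const_mul (-(Real.pi / σ))
  refine (h.exp.const_mul (√σ)⁻¹).congr_deriv ?_
  ring

lemma integrable_normalDensity (hσ : 0 < σ) : Integrable (normalDensity σ) :=
  (integrable_exp_neg_mul_sq (by have := Real.pi_pos; positivity)).const_mul _

lemma integral_normalDensity (hσ : 0 < σ) : ∫ x, normalDensity σ x = 1 := by
  unfold normalDensity
  rw [integral_const_mul, integral_gaussian, div_div_cancel₀ Real.pi_ne_zero]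
  exact inv_mul_cancel₀ (Real.sqrt_ne_zero'.2 hσ)

lemma lintegral_normalDensity (hσ : 0 < σ) :
    ∫⁻ x, ENNReal.ofReal (normalDensity σ x) = 1 := by
  rw [← ofReal_integral_eq_lintegral_ofReal (integrable_normalDensity hσ)
    (ae_of_all _ fun x => (normalDensity_pos hσ x).le), integral_normalDensity hσ,
    ENNReal.ofReal_one]

lemma hasDerivAt_normalCdf (t : ℝ) : HasDerivAt (normalCdf σ) (normalDensity σ t) t := by
  unfold normalCdf
  exact (intervalIntegral.integral_hasDerivAt_right
    (continuous_normalDensity.intervalIntegrable _ _)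
    (continuous_normalDensity.stronglyMeasurableAtFilter _ _)
    continuous_normalDensity.continuousAt).const_add _

lemma continuous_normalCdf : Continuous (normalCdf σ) :=
  continuous_iff_continuousAt.2 fun t => (hasDerivAt_normalCdf t).continuousAt

lemma strictMono_normalCdf (hσ : 0 < σ) : StrictMono (normalCdf σ) :=
  strictMono_of_hasDerivAt_pos hasDerivAt_normalCdf fun t => normalDensity_pos hσ t

lemma tendsto_normalCdf_atTop (hσ : 0 < σ) : Tendsto (normalCdf σ) atTop (𝓝 1) := by
  have h := intervalIntegral_tendsto_integral_Ioi (0 : ℝ)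
    (integrable_normalDensity hσ).integrableOn tendsto_id
  have h2 : ∫ x in Ioi (0 : ℝ), normalDensity σ x = 1 / 2 := by
    unfold normalDensity
    rw [integral_const_mul, integral_gaussian_Ioi, div_div_cancel₀ Real.pi_ne_zero,
      ← mul_div_assoc, inv_mul_cancel₀ (Real.sqrt_ne_zero'.2 hσ)]
  rw [h2] at h
  have h3 := h.const_add (1 / 2 : ℝ)
  rw [add_halves] at h3
  exact h3

lemma normalCdf_neg (t : ℝ) : normalCdf σ (-t) = 1 - normalCdf σ t := by
  have h : ∫ s in (0 : ℝ)..t, normalDensity σ (-s) = ∫ s in (0 : ℝ)..t, normalDensity σ s := by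
    simp [normalDensity]
  rw [intervalIntegral.integral_comp_neg, neg_zero, intervalIntegral.integral_symm] at h
  unfold normalCdf
  linarith

lemma tendsto_normalCdf_atBot (hσ : 0 < σ) : Tendsto (normalCdf σ) atBot (𝓝 0) := by
  have h := ((tendsto_normalCdf_atTop hσ).comp tendsto_neg_atBot_atTop).const_sub 1
  rw [sub_self] at h
  refine h.congr fun t => ?_
  simp [normalCdf_neg]

lemma normalCdf_lt_one (hσ : 0 < σ) (t : ℝ) : normalCdf σ t < 1 :=
  (strictMono_normalCdf hσ (lt_add_one t)).trans_le
    ((strictMono_normalCdf hσ).monotone.ge_of_tendsto (tendsto_normalCdf_atTop hσ) _)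

lemma normalCdf_pos (hσ : 0 < σ) (t : ℝ) : 0 < normalCdf σ t := by
  have := normalCdf_lt_one hσ (-t)
  rw [normalCdf_neg] at this
  linarith

lemma exists_normalCdf_eq (hσ : 0 < σ) {p : ℝ} (h0 : 0 < p) (h1 : p < 1) :
    ∃ t, normalCdf σ t = p := by
  obtain ⟨a, ha⟩ := ((tendsto_normalCdf_atBot hσ).eventually_lt_const h0).exists
  obtain ⟨b, hb⟩ := ((tendsto_normalCdf_atTop hσ).eventually_const_lt h1).exists
  obtain ⟨t, ht⟩ := mem_range_of_exists_le_of_exists_ge continuous_normalCdf ⟨a, ha.le⟩ ⟨b, hb.le⟩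
  exact ⟨t, ht⟩

/-- The isoperimetric profile of the normal law is concave: it lies below its tangents. -/
lemma normalDensity_le_tangent (hσ : 0 < σ) (s t : ℝ) :
    normalDensity σ s ≤
      normalDensity σ t - 2 * Real.pi * t / σ * (normalCdf σ s - normalCdf σ t) := by
  -- The gap vanishes at s = t, and its derivative has the sign of s - t, so t is its minimum.
  let d : ℝ → ℝ := fun s => normalDensity σ t - 2 * Real.pi * t / σ * (normalCdf σ s - normalCdf σ t)
    - normalDensity σ s
  have hd : ∀ s, HasDerivAt d (2 * Real.pi / σ * (s - t) * normalDensity σ s) s := by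
    intro s
    have := ((((hasDerivAt_normalCdf (σ := σ) s).sub_const (normalCdf σ t)).const_mul
      (2 * Real.pi * t / σ)).const_sub (normalDensity σ t)).sub (hasDerivAt_normalDensity (σ := σ) s)
    refine this.congr_deriv ?_
    ring
  have hdt : d t = 0 := by simp [d]
  have hcont : Continuous d := continuous_iff_continuousAt.2 fun s => (hd s).continuousAt
  have hpi := Real.pi_pos
  suffices 0 ≤ d s by simpa [d] using this
  rcases le_total t s with h | h
  · have : MonotoneOn d (Ici t) := by
      refine monotoneOn_of_deriv_nonneg (convex_Ici t) hcont.continuousOn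
        (fun x _ => (hd x).differentiableAt.differentiableWithinAt) fun x hx => ?_
      rw [interior_Ici] at hx
      rw [(hd x).deriv]
      have := (normalDensity_pos hσ x).le
      have h2 : 0 ≤ x - t := sub_nonneg.2 (le_of_lt hx)
      positivity
    rw [← hdt]
    exact this self_mem_Ici h h
  · have : AntitoneOn d (Iic t) := by
      refine antitoneOn_of_deriv_nonpos (convex_Iic t) hcont.continuousOn
        (fun x _ => (hd x).differentiableAt.differentiableWithinAt) fun x hx => ?_
      rw [interior_Iic] at hx
      rw [(hd x).deriv]
      have := (normalDensity_pos hσ x).le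
      have h2 : x - t ≤ 0 := sub_nonpos.2 (le_of_lt hx)
      exact mul_nonpos_of_nonpos_of_nonneg
        (mul_nonpos_of_nonneg_of_nonpos (by positivity) h2) this
    rw [← hdt]
    exact this h self_mem_Iic h

end NormalDensity

/-! ### Monotone transport to the normal law -/

/-- A monotone rearrangement `T` taking a density proportional to `f` to `normalDensity σ`:
`T` is differentiable with derivative `l`, and `f = m * l * normalDensity σ ∘ T`. -/
structure NormalTransport (σ m : ℝ) (f T l : ℝ → ℝ) : Prop where
  hasDerivAt : ∀ x, HasDerivAt T (l x) x
  continuous_deriv : Continuous l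
  deriv_pos : ∀ x, 0 < l x
  deriv_le_one : ∀ x, l x ≤ 1
  eq : ∀ x, f x = m * l x * normalDensity σ (T x)

section Transport

variable {σ : ℝ} (μ : Measure ℝ) [IsFiniteMeasure μ]

lemma integrable_normalDensity_sub (hσ : 0 < σ) (x : ℝ) :
    Integrable (fun y => normalDensity σ (x - y)) μ := by
  refine Integrable.of_bound (C := (√σ)⁻¹)
    (by fun_prop : Continuous fun y => normalDensity σ (x - y)).aestronglyMeasurable
    (ae_of_all _ fun y => ?_)
  rw [Real.norm_of_nonneg (normalDensity_pos hσ _).le]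
  exact normalDensity_le hσ _

lemma integrable_normalCdf_sub (hσ : 0 < σ) (x : ℝ) :
    Integrable (fun y => normalCdf σ (x - y)) μ := by
  refine Integrable.of_bound (C := 1)
    (continuous_normalCdf.comp (by fun_prop : Continuous fun y => x - y)).aestronglyMeasurable
    (ae_of_all _ fun y => ?_)
  rw [Real.norm_of_nonneg (normalCdf_pos hσ _).le]
  exact (normalCdf_lt_one hσ _).le

lemma continuous_integral_normalDensity_sub (hσ : 0 < σ) :
    Continuous fun x => ∫ y, normalDensity σ (x - y) ∂μ := by
  refine continuous_of_dominated (bound := fun _ => (√σ)⁻¹)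
    (fun x => (integrable_normalDensity_sub μ hσ x).aestronglyMeasurable)
    (fun x => ae_of_all _ fun y => ?_) (integrable_const _)
    (ae_of_all _ fun y => by fun_prop)
  rw [Real.norm_of_nonneg (normalDensity_pos hσ _).le]
  exact normalDensity_le hσ _

lemma hasDerivAt_integral_normalCdf_sub (hσ : 0 < σ) (x : ℝ) :
    HasDerivAt (fun x => ∫ y, normalCdf σ (x - y) ∂μ) (∫ y, normalDensity σ (x - y) ∂μ) x := by
  refine (hasDerivAt_integral_of_dominated_loc_of_deriv_le (bound := fun _ => (√σ)⁻¹)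
    (F' := fun x y => normalDensity σ (x - y)) univ_mem
    (Eventually.of_forall fun x => (integrable_normalCdf_sub μ hσ x).aestronglyMeasurable)
    (integrable_normalCdf_sub μ hσ x)
    (integrable_normalDensity_sub μ hσ x).aestronglyMeasurable
    (ae_of_all _ fun y z _ => ?_) (integrable_const _) (ae_of_all _ fun y z _ => ?_)).2
  · rw [Real.norm_of_nonneg (normalDensity_pos hσ _).le]
    exact normalDensity_le hσ _
  · exact ((hasDerivAt_normalCdf (σ := σ) (z - y)).comp z
      ((hasDerivAt_id z).sub_const y)).congr_deriv (mul_one _)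

variable [NeZero μ]

lemma measureReal_univ_pos_of_neZero : 0 < μ.real univ := by
  rw [measureReal_def, ENNReal.toReal_pos_iff]
  exact ⟨Measure.measure_univ_pos.2 (NeZero.ne μ), measure_lt_top _ _⟩

/-- The map is the normal quantile of F/m, where F is the distribution function of f. Since F/m
averages `normalCdf σ (x - y)` over μ, Jensen's inequality for the concave profile gives T' ≤ 1. If
y stays in [-R, R], the average lies between the values of `normalCdf σ` at x - R and x + R, which
bounds T x - x. -/
lemma exists_normalTransport (hσ : 0 < σ) :
    ∃ T l, NormalTransport σ (μ.real univ) (fun x => ∫ y, normalDensity σ (x - y) ∂μ) T l ∧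
      ∀ R, μ (Icc (-R) R)ᶜ = 0 → ∀ x, |T x - x| ≤ R := by
  set m := μ.real univ with hm
  have hm0 : 0 < m := measureReal_univ_pos_of_neZero μ
  set f : ℝ → ℝ := fun x => ∫ y, normalDensity σ (x - y) ∂μ with hf
  set F : ℝ → ℝ := fun x => ∫ y, normalCdf σ (x - y) ∂μ with hF
  have hle : ∀ g h : ℝ → ℝ, Integrable g μ → Integrable h μ → (∀ x, g x < h x) →
      ∫ x, g x ∂μ < ∫ x, h x ∂μ := by
    intro g h hg hh hlt
    rw [← sub_pos, ← integral_sub hh hg]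
    rw [integral_pos_iff_support_of_nonneg (fun x => (sub_pos.2 (hlt x)).le) (hh.sub hg)]
    have : Function.support (fun x => h x - g x) = univ := by
      ext x; simp [(sub_pos.2 (hlt x)).ne']
    rw [this]
    exact Measure.measure_univ_pos.2 (NeZero.ne μ)
  have hF0 : ∀ x, 0 < F x := fun x => by
    simpa using hle 0 _ (integrable_zero _ _ _) (integrable_normalCdf_sub μ hσ x)
      fun y => normalCdf_pos hσ _
  have hF1 : ∀ x, F x < m := fun x => by
    simpa using hle _ (fun _ => 1) (integrable_normalCdf_sub μ hσ x) (integrable_const 1)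
      fun y => normalCdf_lt_one hσ _
  have hf0 : ∀ x, 0 < f x := fun x => by
    simpa using hle 0 _ (integrable_zero _ _ _) (integrable_normalDensity_sub μ hσ x)
      fun y => normalDensity_pos hσ _
  -- The quantile function `q` is specified only on (0, 1), where F/m takes its values.
  have hex : ∀ p : ℝ, ∃ t, p ∈ Ioo (0 : ℝ) 1 → normalCdf σ t = p := fun p => by
    by_cases h : p ∈ Ioo (0 : ℝ) 1
    · obtain ⟨t, ht⟩ := exists_normalCdf_eq hσ h.1 h.2
      exact ⟨t, fun _ => ht⟩
    · exact ⟨0, fun h' => absurd h' h⟩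
  choose q hq using hex
  have hqcdf : ∀ t, q (normalCdf σ t) = t := fun t =>
    (strictMono_normalCdf hσ).injective (hq _ ⟨normalCdf_pos hσ t, normalCdf_lt_one hσ t⟩)
  have hqmono : StrictMonoOn q (Ioo 0 1) := by
    intro a ha b hb hab
    rw [← (strictMono_normalCdf hσ).lt_iff_lt, hq a ha, hq b hb]
    exact hab
  have hqimg : q '' Ioo 0 1 = univ := eq_univ_of_forall fun t =>
    ⟨_, ⟨normalCdf_pos hσ t, normalCdf_lt_one hσ t⟩, hqcdf t⟩
  have hqcont : ∀ p ∈ Ioo (0 : ℝ) 1, ContinuousAt q p := fun p hp =>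
    hqmono.continuousAt_of_image_mem_nhds (Ioo_mem_nhds hp.1 hp.2) (by rw [hqimg]; exact univ_mem)
  have hqderiv : ∀ p ∈ Ioo (0 : ℝ) 1, HasDerivAt q (normalDensity σ (q p))⁻¹ p := fun p hp =>
    HasDerivAt.of_local_left_inverse (hqcont p hp) (hasDerivAt_normalCdf _)
      (normalDensity_pos hσ _).ne' (by
        filter_upwards [Ioo_mem_nhds hp.1 hp.2] with y hy using hq y hy)
  have hFm : ∀ x, F x / m ∈ Ioo (0 : ℝ) 1 := fun x =>
    ⟨div_pos (hF0 x) hm0, (div_lt_one hm0).2 (hF1 x)⟩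
  let T : ℝ → ℝ := fun x => q (F x / m)
  have hT : ∀ x, normalCdf σ (T x) = F x / m := fun x => hq _ (hFm x)
  have hTd : ∀ x, HasDerivAt T (f x / (m * normalDensity σ (T x))) x := by
    intro x
    have := (hqderiv _ (hFm x)).comp x ((hasDerivAt_integral_normalCdf_sub μ hσ x).div_const m)
    refine this.congr_deriv ?_
    change (normalDensity σ (T x))⁻¹ * (f x / m) = _
    have := (normalDensity_pos hσ (T x)).ne'
    field_simp
  have hTc : Continuous T := continuous_iff_continuousAt.2 fun x => (hTd x).continuousAt
  have hmg : ∀ x, 0 < m * normalDensity σ (T x) := fun x => mul_pos hm0 (normalDensity_pos hσ _)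
  refine ⟨T, fun x => f x / (m * normalDensity σ (T x)), ⟨hTd, ?_, fun x => div_pos (hf0 x) (hmg x),
    fun x => ?_, fun x => ?_⟩, fun R hR x => ?_⟩
  · exact (continuous_integral_normalDensity_sub μ hσ).div₀
      (continuous_const.mul (continuous_normalDensity.comp hTc)) fun x => (hmg x).ne'
  · rw [div_le_one (hmg x)]
    -- Jensen: integrate the tangent bound at T x. The linear term drops out because `normalCdf σ (T
    -- x)` is the mean of `normalCdf σ (x - y)`.
    have h1 : f x ≤ ∫ y, (normalDensity σ (T x) -
        2 * Real.pi * T x / σ * (normalCdf σ (x - y) - normalCdf σ (T x))) ∂μ :=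
      integral_mono (integrable_normalDensity_sub μ hσ x)
        ((integrable_const _).sub (((integrable_normalCdf_sub μ hσ x).sub
          (integrable_const _)).const_mul _)) fun y => normalDensity_le_tangent hσ _ _
    have hi : Integrable (fun y => normalCdf σ (x - y) - normalCdf σ (T x)) μ :=
      (integrable_normalCdf_sub μ hσ x).sub (integrable_const _)
    rw [integral_sub (integrable_const _) (hi.const_mul _), integral_const_mul,
      integral_sub (integrable_normalCdf_sub μ hσ x) (integrable_const _)] at h1
    have h2 : ∫ y, normalCdf σ (x - y) ∂μ = m * normalCdf σ (T x) := by
      rw [hT]; field_simp; rfl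
    simpa [h2, ← hm] using h1
  · have := (normalDensity_pos hσ (T x)).ne'
    field_simp
  · have hmem : ∀ᵐ y ∂μ, y ∈ Icc (-R) R := by rw [ae_iff]; exact hR
    rw [abs_le, neg_le_sub_iff_le_add, sub_le_iff_le_add]
    rw [← (strictMono_normalCdf hσ).le_iff_le (b := R + x)]
    have h3 : x ≤ T x + R ↔ normalCdf σ (x - R) ≤ normalCdf σ (T x) := by
      rw [(strictMono_normalCdf hσ).le_iff_le]; exact sub_le_iff_le_add.symm
    rw [h3, hT, le_div_iff₀ hm0, div_le_iff₀ hm0]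
    constructor
    · have := integral_mono_ae (integrable_const (normalCdf σ (x - R)))
        (integrable_normalCdf_sub μ hσ x) (by
          filter_upwards [hmem] with y hy
          exact (strictMono_normalCdf hσ).monotone (by linarith [hy.2]))
      simpa [← hm, mul_comm] using this
    · have := integral_mono_ae (integrable_normalCdf_sub μ hσ x)
        (integrable_const (normalCdf σ (R + x))) (by
          filter_upwards [hmem] with y hy
          exact (strictMono_normalCdf hσ).monotone (by linarith [hy.1]))
      simpa [← hm, mul_comm] using this

end Transport

/-! ### Gaussian integrals in one and two variables -/

lemma lintegral_exp_neg_pi_mul_sq {b : ℝ} (hb : 0 < b) (c : ℝ) :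
    ∫⁻ x : ℝ, ENNReal.ofReal (Real.exp (-Real.pi * (b * (x - c) ^ 2))) =
      ENNReal.ofReal (√b)⁻¹ := by
  have hpi := Real.pi_pos
  rw [lintegral_sub_right_eq_self (fun x => ENNReal.ofReal (Real.exp (-Real.pi * (b * x ^ 2)))) c]
  have h : ∀ x : ℝ, Real.exp (-Real.pi * (b * x ^ 2)) = Real.exp (-(Real.pi * b) * x ^ 2) :=
    fun x => by ring_nf
  simp_rw [h]
  rw [← ofReal_integral_eq_lintegral_ofReal (integrable_exp_neg_mul_sq (by positivity))
    (ae_of_all _ fun x => (Real.exp_pos _).le), integral_gaussian, div_mul_cancel_left₀ hpi.ne',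
    Real.sqrt_inv]

/-- The second elementary symmetric function of three numbers. It is the determinant of the
quadratic form `a 0 * x ^ 2 + a 1 * y ^ 2 + a 2 * (x - y) ^ 2`. -/
def pairSum (a : Fin 3 → ℝ) : ℝ := a 0 * a 1 + a 0 * a 2 + a 1 * a 2

lemma lintegral_exp_quadratic {b : Fin 3 → ℝ} (hb : 0 < b 1 + b 2) (hD : 0 < pairSum b) :
    ∫⁻ p : ℝ × ℝ, ENNReal.ofReal (Real.exp
      (-Real.pi * (b 0 * p.1 ^ 2 + b 1 * p.2 ^ 2 + b 2 * (p.1 - p.2) ^ 2))) =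
      ENNReal.ofReal (√(pairSum b))⁻¹ := by
  rw [Measure.volume_eq_prod, lintegral_prod _ (by fun_prop)]
  have h : ∀ x y : ℝ, Real.exp (-Real.pi * (b 0 * x ^ 2 + b 1 * y ^ 2 + b 2 * (x - y) ^ 2)) =
      Real.exp (-Real.pi * (pairSum b / (b 1 + b 2) * (x - 0) ^ 2)) *
        Real.exp (-Real.pi * ((b 1 + b 2) * (y - b 2 * x / (b 1 + b 2)) ^ 2)) := by
    intro x y
    rw [← Real.exp_add, pairSum]
    congr 1
    field_simp
    ring
  simp_rw [h, ENNReal.ofReal_mul (Real.exp_pos _).le]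
  have h2 : ∀ x : ℝ, ∫⁻ y : ℝ, ENNReal.ofReal (Real.exp
      (-Real.pi * (pairSum b / (b 1 + b 2) * (x - 0) ^ 2))) * ENNReal.ofReal (Real.exp
      (-Real.pi * ((b 1 + b 2) * (y - b 2 * x / (b 1 + b 2)) ^ 2))) =
      ENNReal.ofReal (Real.exp (-Real.pi * (pairSum b / (b 1 + b 2) * (x - 0) ^ 2))) *
        ENNReal.ofReal (√(b 1 + b 2))⁻¹ := fun x => by
    rw [lintegral_const_mul _ (by fun_prop), lintegral_exp_neg_pi_mul_sq hb]
  simp_rw [h2]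
  rw [lintegral_mul_const _ (by fun_prop), lintegral_exp_neg_pi_mul_sq (div_pos hD hb),
    ← ENNReal.ofReal_mul (by positivity), ← mul_inv, ← Real.sqrt_mul (div_pos hD hb).le,
    div_mul_cancel₀ _ hb.ne']

/-- The convolution of two normal densities is normal. -/
lemma lintegral_normalDensity_sub_withDensity {σ τ : ℝ} (hσ : 0 < σ) (hτ : 0 < τ) (x : ℝ) :
    ∫⁻ y, ENNReal.ofReal (normalDensity σ (x - y))
      ∂(volume.withDensity fun y => ENNReal.ofReal (normalDensity τ y)) =
      ENNReal.ofReal (normalDensity (σ + τ) x) := by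
  rw [lintegral_withDensity_eq_lintegral_mul _ (by fun_prop) (by fun_prop)]
  have hb : 0 < (σ + τ) / (σ * τ) := by positivity
  have h : ∀ y, normalDensity τ y * normalDensity σ (x - y) =
      ((√τ)⁻¹ * (√σ)⁻¹ * Real.exp (-(Real.pi / (σ + τ)) * x ^ 2)) *
        Real.exp (-Real.pi * ((σ + τ) / (σ * τ) * (y - τ * x / (σ + τ)) ^ 2)) := by
    intro y
    have : -(Real.pi / τ) * y ^ 2 + -(Real.pi / σ) * (x - y) ^ 2 = -(Real.pi / (σ + τ)) * x ^ 2 +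
        -Real.pi * ((σ + τ) / (σ * τ) * (y - τ * x / (σ + τ)) ^ 2) := by
      field_simp
      ring
    unfold normalDensity
    rw [mul_mul_mul_comm, mul_assoc (_ * _), ← Real.exp_add, ← Real.exp_add, this]
  simp_rw [Pi.mul_apply, ← ENNReal.ofReal_mul (normalDensity_pos hτ _).le, h]
  simp_rw [ENNReal.ofReal_mul (show 0 ≤ (√τ)⁻¹ * (√σ)⁻¹ * Real.exp (-(Real.pi / (σ + τ)) * x ^ 2)
    by positivity)]
  rw [lintegral_const_mul _ (by fun_prop), lintegral_exp_neg_pi_mul_sq hb,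
    ← ENNReal.ofReal_mul (by positivity)]
  congr 1
  unfold normalDensity
  rw [Real.sqrt_div (by positivity), Real.sqrt_mul hσ.le]
  have h1 := (Real.sqrt_pos.2 hσ).ne'
  have h2 := (Real.sqrt_pos.2 hτ).ne'
  have h3 := (Real.sqrt_pos.2 (add_pos hσ hτ)).ne'
  field_simp

/-! ### The gradient map, its determinant and the dual form -/

@[simp] lemma youngMap_zero (p : ℝ × ℝ) : youngMap 0 p = p.1 := rfl
@[simp] lemma youngMap_one (p : ℝ × ℝ) : youngMap 1 p = p.2 := rfl
@[simp] lemma youngMap_two (p : ℝ × ℝ) : youngMap 2 p = p.1 - p.2 := rfl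

/-- The gradient of `a 0 * ψ 0 x + a 1 * ψ 1 y + a 2 * ψ 2 (x - y)`, where `T j` is the
derivative of `ψ j`, with the sign of the second coordinate changed. -/
def youngGrad (a : Fin 3 → ℝ) (T : Fin 3 → ℝ → ℝ) (p : ℝ × ℝ) : ℝ × ℝ :=
  (a 0 * T 0 p.1 + a 2 * T 2 (p.1 - p.2), a 2 * T 2 (p.1 - p.2) - a 1 * T 1 p.2)

/-- The derivative of `youngGrad a T`, where `l j` is the derivative of `T j`. -/
noncomputable def youngGradDeriv (a : Fin 3 → ℝ) (l : Fin 3 → ℝ → ℝ) (p : ℝ × ℝ) :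
    ℝ × ℝ →L[ℝ] ℝ × ℝ :=
  ((a 0 * l 0 p.1) • ContinuousLinearMap.fst ℝ ℝ ℝ +
    (a 2 * l 2 (p.1 - p.2)) • (ContinuousLinearMap.fst ℝ ℝ ℝ - ContinuousLinearMap.snd ℝ ℝ ℝ)).prod
  ((a 2 * l 2 (p.1 - p.2)) • (ContinuousLinearMap.fst ℝ ℝ ℝ - ContinuousLinearMap.snd ℝ ℝ ℝ) -
    (a 1 * l 1 p.2) • ContinuousLinearMap.snd ℝ ℝ ℝ)

lemma hasFDerivAt_youngGrad {a : Fin 3 → ℝ} {T l : Fin 3 → ℝ → ℝ}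
    (hT : ∀ j x, HasDerivAt (T j) (l j x) x) (p : ℝ × ℝ) :
    HasFDerivAt (youngGrad a T) (youngGradDeriv a l p) p := by
  have h0 : HasFDerivAt (fun p : ℝ × ℝ => a 0 * T 0 p.1)
      ((a 0 * l 0 p.1) • ContinuousLinearMap.fst ℝ ℝ ℝ) p :=
    ((hT 0 p.1).const_mul (a 0)).comp_hasFDerivAt p hasFDerivAt_fst
  have h1 : HasFDerivAt (fun p : ℝ × ℝ => a 1 * T 1 p.2)
      ((a 1 * l 1 p.2) • ContinuousLinearMap.snd ℝ ℝ ℝ) p :=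
    ((hT 1 p.2).const_mul (a 1)).comp_hasFDerivAt p hasFDerivAt_snd
  have h2 : HasFDerivAt (fun p : ℝ × ℝ => a 2 * T 2 (p.1 - p.2))
      ((a 2 * l 2 (p.1 - p.2)) •
        (ContinuousLinearMap.fst ℝ ℝ ℝ - ContinuousLinearMap.snd ℝ ℝ ℝ)) p :=
    ((hT 2 (p.1 - p.2)).const_mul (a 2)).comp_hasFDerivAt (f := fun p : ℝ × ℝ => p.1 - p.2) p
      (hasFDerivAt_fst.sub hasFDerivAt_snd)
  exact (h0.add h2).prodMk (h2.sub h1)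

lemma det_youngGradDeriv (a : Fin 3 → ℝ) (l : Fin 3 → ℝ → ℝ) (p : ℝ × ℝ) :
    (youngGradDeriv a l p).det = -pairSum fun j => a j * l j (youngMap j p) := by
  rw [ContinuousLinearMap.det, ← LinearMap.det_toMatrix (Module.Basis.finTwoProd ℝ),
    Matrix.det_fin_two]
  simp [LinearMap.toMatrix_apply, youngGradDeriv, pairSum]
  ring

/-- The dual quadratic form at the gradient is, up to a multiple of a square, the energy. -/
lemma energy_eq {a : Fin 3 → ℝ} (hD : pairSum a ≠ 0) (z : Fin 3 → ℝ) :
    ∑ j, a j * z j ^ 2 =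
      a 1 / pairSum a * (a 0 * z 0 + a 2 * z 2) ^ 2 + a 0 / pairSum a * (a 2 * z 2 - a 1 * z 1) ^ 2 +
        a 2 / pairSum a * ((a 0 * z 0 + a 2 * z 2) - (a 2 * z 2 - a 1 * z 1)) ^ 2 +
        a 0 * a 1 * a 2 / pairSum a * (z 0 - z 1 - z 2) ^ 2 := by
  rw [Fin.sum_univ_three]
  field_simp
  unfold pairSum
  ring

/-- The density `exp (-π Q)` for the form `Q` dual to `a 0 * x ^ 2 + a 1 * y ^ 2 + a 2 * (x - y) ^ 2`
(with the sign of the second coordinate changed). -/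
noncomputable def dualGaussian (a : Fin 3 → ℝ) (p : ℝ × ℝ) : ℝ :=
  Real.exp (-Real.pi * (a 1 / pairSum a * p.1 ^ 2 + a 0 / pairSum a * p.2 ^ 2 +
    a 2 / pairSum a * (p.1 - p.2) ^ 2))

lemma lintegral_dualGaussian {a : Fin 3 → ℝ} (ha : 0 < a 0 + a 2) (hD : 0 < pairSum a) :
    ∫⁻ p, ENNReal.ofReal (dualGaussian a p) = ENNReal.ofReal √(pairSum a) := by
  -- The dual form has the inverse determinant.
  have h1 : pairSum ![a 1 / pairSum a, a 0 / pairSum a, a 2 / pairSum a] = (pairSum a)⁻¹ := by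
    have : pairSum ![a 1 / pairSum a, a 0 / pairSum a, a 2 / pairSum a] =
        pairSum a / (pairSum a * pairSum a) := by
      simp only [pairSum, Matrix.cons_val]
      rw [← pairSum]
      field_simp
      unfold pairSum
      ring
    rw [this]
    field_simp
  have h := lintegral_exp_quadratic (b := ![a 1 / pairSum a, a 0 / pairSum a, a 2 / pairSum a])
    (by simpa [← add_div] using div_pos ha hD) (by rw [h1]; positivity)
  rw [h1, Real.sqrt_inv, inv_inv] at h
  exact h

@[fun_prop]
lemma continuous_dualGaussian (a : Fin 3 → ℝ) : Continuous (dualGaussian a) := by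
  unfold dualGaussian; fun_prop

/-- Integral of the transported Gaussian integrand: upper bound, for positive weights. -/
theorem lintegral_transport_le {a c : Fin 3 → ℝ} {T l : Fin 3 → ℝ → ℝ} (ha : ∀ j, 0 < a j)
    (hT : ∀ j x, HasDerivAt (T j) (l j x) x) (hl : ∀ j x, 0 < l j x)
    (hdet : ∀ p, pairSum a * ∏ j, l j (youngMap j p) ^ c j ≤
      pairSum fun j => a j * l j (youngMap j p)) :
    ∫⁻ p, ENNReal.ofReal ((∏ j, l j (youngMap j p) ^ c j) *
      Real.exp (-Real.pi * ∑ j, a j * T j (youngMap j p) ^ 2)) ≤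
      ENNReal.ofReal (√(pairSum a))⁻¹ := by
  have hD : 0 < pairSum a := by
    have := ha 0; have := ha 1; have := ha 2
    unfold pairSum; positivity
  have hmono : ∀ j, StrictMono (T j) := fun j => strictMono_of_hasDerivAt_pos (hT j) (hl j)
  have hmul : ∀ j s t, 0 ≤ (T j s - T j t) * (s - t) := fun j s t => by
    rcases le_total s t with h | h
    · exact mul_nonneg_of_nonpos_of_nonpos (sub_nonpos.2 ((hmono j).monotone h)) (sub_nonpos.2 h)
    · exact mul_nonneg (sub_nonneg.2 ((hmono j).monotone h)) (sub_nonneg.2 h)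
  have hzero : ∀ j s t, (T j s - T j t) * (s - t) = 0 → s = t := fun j s t h => by
    rcases mul_eq_zero.1 h with h | h
    · exact (hmono j).injective (sub_eq_zero.1 h)
    · exact sub_eq_zero.1 h
  have hinj : Function.Injective (youngGrad a T) := by
    rintro ⟨x, y⟩ ⟨x', y'⟩ h
    simp only [youngGrad, Prod.mk.injEq] at h
    -- Monotonicity of a gradient: pairing the difference of the values with the difference of the
    -- points gives a sum of nonnegative terms, so each of them vanishes.
    have hsum : a 0 * ((T 0 x - T 0 x') * (x - x')) + a 1 * ((T 1 y - T 1 y') * (y - y')) +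
        a 2 * ((T 2 (x - y) - T 2 (x' - y')) * ((x - y) - (x' - y'))) = 0 := by
      linear_combination (x - x') * h.1 - (y - y') * h.2
    have p0 := mul_nonneg (ha 0).le (hmul 0 x x')
    have p1 := mul_nonneg (ha 1).le (hmul 1 y y')
    have p2 := mul_nonneg (ha 2).le (hmul 2 (x - y) (x' - y'))
    have e0 := (mul_eq_zero.1 (by linarith : a 0 * ((T 0 x - T 0 x') * (x - x')) = 0)).resolve_left
      (ha 0).ne'
    have e1 := (mul_eq_zero.1 (by linarith : a 1 * ((T 1 y - T 1 y') * (y - y')) = 0)).resolve_left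
      (ha 1).ne'
    rw [hzero 0 _ _ e0, hzero 1 _ _ e1]
  have key : ENNReal.ofReal (pairSum a) * ∫⁻ p, ENNReal.ofReal ((∏ j, l j (youngMap j p) ^ c j) *
      Real.exp (-Real.pi * ∑ j, a j * T j (youngMap j p) ^ 2)) ≤
      ENNReal.ofReal √(pairSum a) := by
    rw [← lintegral_dualGaussian (add_pos (ha 0) (ha 2)) hD,
      ← lintegral_const_mul' _ _ ENNReal.ofReal_ne_top]
    calc _ ≤ ∫⁻ p in univ, ENNReal.ofReal |(youngGradDeriv a l p).det| *
          ENNReal.ofReal (dualGaussian a (youngGrad a T p)) := by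
          rw [setLIntegral_univ]
          refine lintegral_mono fun p => ?_
          rw [← ENNReal.ofReal_mul hD.le, ← ENNReal.ofReal_mul (abs_nonneg _)]
          refine ENNReal.ofReal_le_ofReal ?_
          rw [← mul_assoc, det_youngGradDeriv, abs_neg]
          refine mul_le_mul ((hdet p).trans (le_abs_self _)) ?_ (Real.exp_pos _).le (abs_nonneg _)
          refine Real.exp_le_exp.2 ?_
          rw [energy_eq hD.ne']
          refine mul_le_mul_of_nonpos_left ?_ (neg_nonpos.2 Real.pi_pos.le)
          refine le_add_of_nonneg_right ?_
          have := ha 0; have := ha 1; have := ha 2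
          positivity
      _ = ∫⁻ p in youngGrad a T '' univ, ENNReal.ofReal (dualGaussian a p) :=
          (lintegral_image_eq_lintegral_abs_det_fderiv_mul volume MeasurableSet.univ
            (fun p _ => (hasFDerivAt_youngGrad hT p).hasFDerivWithinAt) hinj.injOn
            fun p => ENNReal.ofReal (dualGaussian a p)).symm
      _ ≤ _ := setLIntegral_le_lintegral _ _
  rw [← ENNReal.mul_le_mul_iff_right (ENNReal.ofReal_pos.2 hD).ne' ENNReal.ofReal_ne_top,
    ← ENNReal.ofReal_mul hD.le]
  refine key.trans_eq ?_
  congr 1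
  rw [← div_eq_mul_inv, Real.div_sqrt]

/-! ### Surjectivity of the gradient map and the lower bound -/

/-- A negative second derivative would make x a local maximum as well, so f would be constant near x
and its second derivative zero. -/
lemma deriv_deriv_nonneg_of_isLocalMin {f f' : ℝ → ℝ} {f'' x : ℝ} (hmin : IsLocalMin f x)
    (hf : ∀ t, HasDerivAt f (f' t) t) (hf' : HasDerivAt f' f'' x) : 0 ≤ f'' := by
  have hd : deriv f = f' := funext fun t => (hf t).deriv
  have h0 : f' x = 0 := hmin.hasDerivAt_eq_zero (hf x)
  by_contra! hneg
  have hmax : IsLocalMax f x := isLocalMax_of_deriv_deriv_neg (by rwa [hd, hf'.deriv])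
    (by rw [hd, h0]) (hf x).continuousAt
  have hconst : f =ᶠ[𝓝 x] fun _ => f x := by
    filter_upwards [hmin, hmax] with t h1 h2 using le_antisymm h2 h1
  have hz : f' =ᶠ[𝓝 x] fun _ => 0 := by
    rw [← hd]
    refine hconst.deriv.trans ?_
    simp
  have := hz.deriv_eq
  rw [hf'.deriv, deriv_const] at this
  exact hneg.ne this

/-- A nonnegative binary quadratic form has nonnegative determinant. -/
lemma pairSum_nonneg_of_form_nonneg {b : Fin 3 → ℝ}
    (h : ∀ x y, 0 ≤ b 0 * x ^ 2 + b 1 * y ^ 2 + b 2 * (x - y) ^ 2) : 0 ≤ pairSum b := by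
  have h2 : ∀ t : ℝ, 0 ≤ (b 0 + b 2) * (t * t) + (-2 * b 2) * t + (b 1 + b 2) := fun t => by
    nlinarith [h t 1]
  have := discrim_le_zero h2
  unfold discrim at this
  unfold pairSum
  nlinarith

lemma exists_potential {T l : ℝ → ℝ} (hT : ∀ x, HasDerivAt T (l x) x) :
    ∃ ψ : ℝ → ℝ, ψ 0 = 0 ∧ ∀ x, HasDerivAt ψ (T x) x := by
  have hc : Continuous T := continuous_iff_continuousAt.2 fun x => (hT x).continuousAt
  exact ⟨fun x => ∫ t in (0 : ℝ)..x, T t, by simp, fun x =>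
    intervalIntegral.integral_hasDerivAt_right (hc.intervalIntegrable _ _)
      (hc.stronglyMeasurableAtFilter _ _) hc.continuousAt⟩

/-- A potential whose derivative exceeds `x - K` for `x ≥ 0` and is below `x + K` for `x ≤ 0`
dominates `x ^ 2 / 2 - K * |x|`. -/
lemma le_potential {ψ T : ℝ → ℝ} {K : ℝ} (h0 : ψ 0 = 0) (hψ : ∀ x, HasDerivAt ψ (T x) x)
    (hpos : ∀ x, 0 ≤ x → x - K ≤ T x) (hneg : ∀ x, x ≤ 0 → T x ≤ x + K) (x : ℝ) :
    x ^ 2 / 2 - K * |x| ≤ ψ x := by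
  have hsq : ∀ x : ℝ, HasDerivAt (fun x : ℝ => x ^ 2 / 2) x x := fun x => by
    simpa using (hasDerivAt_pow 2 x).div_const 2
  have hcψ : Continuous ψ := continuous_iff_continuousAt.2 fun x => (hψ x).continuousAt
  rcases le_total 0 x with hx | hx
  · rw [abs_of_nonneg hx]
    have hd : ∀ x, HasDerivAt (fun x => ψ x - (x ^ 2 / 2 - K * x)) (T x - (x - K)) x := fun x =>
      ((hψ x).sub ((hsq x).sub ((hasDerivAt_id x).const_mul K))).congr_deriv (by ring)
    have : MonotoneOn (fun x => ψ x - (x ^ 2 / 2 - K * x)) (Ici 0) := by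
      refine monotoneOn_of_deriv_nonneg (convex_Ici 0) (by fun_prop)
        (fun x _ => (hd x).differentiableAt.differentiableWithinAt) fun x hx => ?_
      rw [interior_Ici] at hx
      rw [(hd x).deriv]
      linarith [hpos x (le_of_lt hx)]
    have := this self_mem_Ici hx hx
    simp [h0] at this
    linarith
  · rw [abs_of_nonpos hx]
    have hd : ∀ x, HasDerivAt (fun x => ψ x - (x ^ 2 / 2 + K * x)) (T x - (x + K)) x := fun x =>
      ((hψ x).sub ((hsq x).add ((hasDerivAt_id x).const_mul K))).congr_deriv (by ring)
    have : AntitoneOn (fun x => ψ x - (x ^ 2 / 2 + K * x)) (Iic 0) := by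
      refine antitoneOn_of_deriv_nonpos (convex_Iic 0) (by fun_prop)
        (fun x _ => (hd x).differentiableAt.differentiableWithinAt) fun x hx => ?_
      rw [interior_Iic] at hx
      rw [(hd x).deriv]
      linarith [hneg x (le_of_lt hx)]
    have := this hx self_mem_Iic hx
    simp [h0] at this
    linarith

/-- A potential with second derivative at most one is at most `x ^ 2 / 2 + K * |x|`. -/
lemma potential_le {ψ T l : ℝ → ℝ} (h0 : ψ 0 = 0) (hψ : ∀ x, HasDerivAt ψ (T x) x)
    (hT : ∀ x, HasDerivAt T (l x) x) (hl : ∀ x, l x ≤ 1) (x : ℝ) :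
    ψ x ≤ x ^ 2 / 2 + |T 0| * |x| := by
  have hsq : ∀ x : ℝ, HasDerivAt (fun x : ℝ => x ^ 2) (2 * x) x := fun x => by
    simpa using (hasDerivAt_pow 2 x)
  have hmono : Monotone fun x => x - T x := by
    refine monotone_of_hasDerivAt_nonneg (fun x => (hasDerivAt_id x).sub (hT x)) fun x => ?_
    simpa using hl x
  -- An upper bound for ψ is a lower bound for x² - ψ, whose derivative minus x is monotone because
  -- T' ≤ 1.
  have := le_potential (ψ := fun x => x ^ 2 - ψ x) (T := fun x => 2 * x - T x) (K := |T 0|)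
    (by simp [h0]) (fun x => (hsq x).sub (hψ x))
    (fun x hx => by have := hmono hx; simp only [zero_sub] at this; linarith [le_abs_self (T 0)])
    (fun x hx => by have := hmono hx; simp only [zero_sub] at this; linarith [neg_abs_le (T 0)]) x
  linarith

/-- Coercivity of a positive definite form in two variables perturbed by linear terms. -/
lemma tendsto_form_sub_linear {a : Fin 3 → ℝ} (ha : 0 < a 0 + a 2) (hD : 0 < pairSum a) (K : ℝ) :
    Tendsto (fun p : ℝ × ℝ => a 0 * p.1 ^ 2 + a 1 * p.2 ^ 2 + a 2 * (p.1 - p.2) ^ 2 -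
      K * (|p.1| + |p.2|)) (cocompact (ℝ × ℝ)) atTop := by
  have ha1 : 0 < a 1 + a 2 := by
    unfold pairSum at hD
    by_contra! h
    nlinarith [mul_nonpos_of_nonneg_of_nonpos ha.le h, sq_nonneg (a 2)]
  -- Half of determinant over trace. The least eigenvalue of a positive definite form exceeds
  -- determinant over trace, so the form minus κ(x² + y²) is still positive definite.
  set κ := pairSum a / (2 * (a 0 + a 2 + (a 1 + a 2))) with hκ
  have hκ0 : 0 < κ := by positivity
  have hform : ∀ x y : ℝ, κ * (x ^ 2 + y ^ 2) ≤ a 0 * x ^ 2 + a 1 * y ^ 2 + a 2 * (x - y) ^ 2 := by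
    intro x y
    have hκ1 : κ * (2 * (a 0 + a 2 + (a 1 + a 2))) = pairSum a := div_mul_cancel₀ _ (by positivity)
    have hκ2 : 0 < a 0 + a 2 - κ := by
      have h1 : 2 * κ * (a 0 + a 2 + (a 1 + a 2)) ≤ (a 0 + a 2) * (a 1 + a 2) := by
        have : pairSum a = (a 0 + a 2) * (a 1 + a 2) - a 2 ^ 2 := by unfold pairSum; ring
        nlinarith [sq_nonneg (a 2)]
      by_contra! h
      nlinarith [mul_le_mul_of_nonneg_right h (add_pos ha ha1).le, mul_pos ha ha1, mul_pos ha ha]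
    have h2 : (a 0 + a 2 - κ) * (a 0 * x ^ 2 + a 1 * y ^ 2 + a 2 * (x - y) ^ 2 -
        κ * (x ^ 2 + y ^ 2)) =
        ((a 0 + a 2 - κ) * x - a 2 * y) ^ 2 + (pairSum a / 2 + κ ^ 2) * y ^ 2 := by
      have : pairSum a / 2 + κ ^ 2 = (a 0 + a 2 - κ) * (a 1 + a 2 - κ) - a 2 ^ 2 := by
        have h3 : pairSum a / 2 = pairSum a - κ * (a 0 + a 2 + (a 1 + a 2)) := by linarith
        rw [h3]; unfold pairSum; ring
      rw [this]; ring
    have h3 : 0 ≤ (a 0 + a 2 - κ) * (a 0 * x ^ 2 + a 1 * y ^ 2 + a 2 * (x - y) ^ 2 -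
        κ * (x ^ 2 + y ^ 2)) := by rw [h2]; positivity
    linarith [nonneg_of_mul_nonneg_right h3 hκ2]
  have hK : ∀ x : ℝ, κ / 2 * x ^ 2 - K ^ 2 / (2 * κ) ≤ κ * x ^ 2 - K * |x| := fun x => by
    have : κ * x ^ 2 - K * |x| - (κ / 2 * x ^ 2 - K ^ 2 / (2 * κ)) = (κ * |x| - K) ^ 2 / (2 * κ) := by
      rw [← sq_abs x]; field_simp; ring
    have h2 : 0 ≤ (κ * |x| - K) ^ 2 / (2 * κ) := by positivity
    linarith
  have hlow : ∀ p : ℝ × ℝ, κ / 2 * ‖p‖ ^ 2 - 2 * (K ^ 2 / (2 * κ)) ≤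
      a 0 * p.1 ^ 2 + a 1 * p.2 ^ 2 + a 2 * (p.1 - p.2) ^ 2 - K * (|p.1| + |p.2|) := by
    intro p
    have h1 := hform p.1 p.2
    have h2 := hK p.1
    have h3 := hK p.2
    have h4 : ‖p‖ ^ 2 ≤ p.1 ^ 2 + p.2 ^ 2 := by
      rw [Prod.norm_def, Real.norm_eq_abs, Real.norm_eq_abs]
      rcases max_choice |p.1| |p.2| with h | h <;> rw [h, sq_abs] <;> nlinarith
    have h5 := mul_le_mul_of_nonneg_left h4 (half_pos hκ0).le
    linarith
  refine tendsto_atTop_mono hlow ?_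
  refine tendsto_atTop_add_const_right _ _ (Tendsto.const_mul_atTop (half_pos hκ0) ?_)
  exact (tendsto_pow_atTop two_ne_zero).comp (tendsto_norm_cocompact_atTop)

/-- The gradient map takes every value at a point where its differential is nonnegative. -/
lemma exists_youngGrad_eq {a : Fin 3 → ℝ} {T l : Fin 3 → ℝ → ℝ} {R : ℝ} (ha0 : a 0 < 0)
    (ha1 : 0 < a 1) (ha2 : 0 < a 2) (hD : 0 < pairSum a)
    (hT : ∀ j x, HasDerivAt (T j) (l j x) x) (hl : ∀ x, l 0 x ≤ 1)
    (hR1 : ∀ x, |T 1 x - x| ≤ R) (hR2 : ∀ x, |T 2 x - x| ≤ R) (ξ : ℝ × ℝ) :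
    ∃ p, youngGrad a T p = ξ ∧ 0 ≤ pairSum fun j => a j * l j (youngMap j p) := by
  have ha : 0 < a 0 + a 2 := by
    unfold pairSum at hD
    by_contra! h
    nlinarith [mul_nonpos_of_nonpos_of_nonneg h ha1.le, mul_neg_of_neg_of_pos ha0 ha2]
  choose ψ hψ0 hψ using fun j => exists_potential (hT j)
  have hlow : ∀ j, (∀ x, |T j x - x| ≤ R) → ∀ x, x ^ 2 / 2 - R * |x| ≤ ψ j x := fun j hR =>
    le_potential (hψ0 j) (hψ j) (fun x _ => by linarith [(abs_le.1 (hR x)).1])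
      (fun x _ => by linarith [(abs_le.1 (hR x)).2])
  have hR0 : 0 ≤ R := (abs_nonneg _).trans (hR1 0)
  -- A critical point of `H` solves `youngGrad a T p = ξ`, and a minimum has nonnegative Hessian
  -- determinant. Coercivity needs lower bounds for ψ_1 and ψ_2 (from T_j being near the identity)
  -- but an upper bound for ψ_0, since a_0 < 0 (from l_0 ≤ 1).
  let H : ℝ × ℝ → ℝ := fun p => a 0 * ψ 0 p.1 + a 1 * ψ 1 p.2 + a 2 * ψ 2 (p.1 - p.2) -
    ξ.1 * p.1 + ξ.2 * p.2
  have hψc : ∀ j, Continuous (ψ j) := fun j =>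
    continuous_iff_continuousAt.2 fun x => (hψ j x).continuousAt
  have hHc : Continuous H := by
    have h0 := hψc 0
    have h1 := hψc 1
    have h2 := hψc 2
    fun_prop
  obtain ⟨K, hK⟩ : ∃ K, ∀ p : ℝ × ℝ, (a 0 * p.1 ^ 2 + a 1 * p.2 ^ 2 + a 2 * (p.1 - p.2) ^ 2 -
      K * (|p.1| + |p.2|)) / 2 ≤ H p := by
    refine ⟨2 * (-a 0 * |T 0 0| + a 1 * R + a 2 * R + |ξ.1| + |ξ.2|), fun p => ?_⟩
    have h0 := mul_le_mul_of_nonpos_left (potential_le (hψ0 0) (hψ 0) (hT 0) hl p.1) ha0.le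
    have h1 := mul_le_mul_of_nonneg_left (hlow 1 hR1 p.2) ha1.le
    have h2 := mul_le_mul_of_nonneg_left (hlow 2 hR2 (p.1 - p.2)) ha2.le
    have h3 : ξ.1 * p.1 ≤ |ξ.1| * |p.1| := by rw [← abs_mul]; exact le_abs_self _
    have h4 : -(|ξ.2| * |p.2|) ≤ ξ.2 * p.2 := by rw [← abs_mul]; exact neg_abs_le _
    have h5 := mul_le_mul_of_nonneg_left (abs_sub p.1 p.2) (mul_nonneg ha2.le hR0)
    have h6 := mul_nonneg (mul_nonneg (neg_pos.2 ha0).le (abs_nonneg (T 0 0))) (abs_nonneg p.2)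
    have h7 := mul_nonneg (mul_nonneg ha1.le hR0) (abs_nonneg p.1)
    have h8 := mul_nonneg (abs_nonneg ξ.1) (abs_nonneg p.2)
    have h9 := mul_nonneg (abs_nonneg ξ.2) (abs_nonneg p.1)
    simp only [H]
    nlinarith
  have hlim : Tendsto H (cocompact (ℝ × ℝ)) atTop :=
    tendsto_atTop_mono hK ((tendsto_form_sub_linear ha hD K).atTop_div_const two_pos)
  obtain ⟨⟨x, y⟩, hmin⟩ := hHc.exists_forall_le hlim
  -- Both optimality conditions are read off along lines through the minimum in direction (e₁, e₂).
  have hcomp : ∀ (f f' : ℝ → ℝ), (∀ x, HasDerivAt f (f' x) x) → ∀ x e t,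
      HasDerivAt (fun t => f (x + t * e)) (f' (x + t * e) * e) t := fun f f' hf x e t =>
    (((hf _).comp t (((hasDerivAt_id t).mul_const e).const_add x))).congr_deriv (by simp)
  have hd1 : ∀ e₁ e₂ t, HasDerivAt (fun t => a 0 * ψ 0 (x + t * e₁) + a 1 * ψ 1 (y + t * e₂) +
      a 2 * ψ 2 (x - y + t * (e₁ - e₂)) - ξ.1 * (x + t * e₁) + ξ.2 * (y + t * e₂))
      (a 0 * (T 0 (x + t * e₁) * e₁) + a 1 * (T 1 (y + t * e₂) * e₂) +
        a 2 * (T 2 (x - y + t * (e₁ - e₂)) * (e₁ - e₂)) - ξ.1 * e₁ + ξ.2 * e₂) t := by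
    intro e₁ e₂ t
    exact ((((((hcomp _ _ (hψ 0) x e₁ t).const_mul (a 0)).add
      ((hcomp _ _ (hψ 1) y e₂ t).const_mul (a 1))).add
      ((hcomp _ _ (hψ 2) (x - y) (e₁ - e₂) t).const_mul (a 2))).sub
      ((hcomp _ _ hasDerivAt_id x e₁ t).const_mul ξ.1)).add
      ((hcomp _ _ hasDerivAt_id y e₂ t).const_mul ξ.2)).congr_deriv (by ring)
  have hd2 : ∀ e₁ e₂, HasDerivAt (fun t => a 0 * (T 0 (x + t * e₁) * e₁) +
      a 1 * (T 1 (y + t * e₂) * e₂) + a 2 * (T 2 (x - y + t * (e₁ - e₂)) * (e₁ - e₂)) -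
      ξ.1 * e₁ + ξ.2 * e₂)
      (a 0 * l 0 x * e₁ ^ 2 + a 1 * l 1 y * e₂ ^ 2 + a 2 * l 2 (x - y) * (e₁ - e₂) ^ 2) 0 := by
    intro e₁ e₂
    refine ((((((hcomp _ _ (hT 0) x e₁ 0).mul_const e₁).const_mul (a 0)).add
      (((hcomp _ _ (hT 1) y e₂ 0).mul_const e₂).const_mul (a 1))).add
      (((hcomp _ _ (hT 2) (x - y) (e₁ - e₂) 0).mul_const (e₁ - e₂)).const_mul (a 2))).sub_const
      (ξ.1 * e₁)).add_const (ξ.2 * e₂) |>.congr_deriv ?_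
    simp only [zero_mul, add_zero]
    ring
  have hloc : ∀ e₁ e₂, IsLocalMin (fun t => a 0 * ψ 0 (x + t * e₁) + a 1 * ψ 1 (y + t * e₂) +
      a 2 * ψ 2 (x - y + t * (e₁ - e₂)) - ξ.1 * (x + t * e₁) + ξ.2 * (y + t * e₂)) 0 := by
    intro e₁ e₂
    refine Eventually.of_forall fun t => ?_
    have := hmin (x + t * e₁, y + t * e₂)
    have e : x + t * e₁ - (y + t * e₂) = x - y + t * (e₁ - e₂) := by ring
    simpa [H, e] using this
  refine ⟨(x, y), ?_, ?_⟩
  · have h1 := (hloc 1 0).hasDerivAt_eq_zero (hd1 1 0 0)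
    have h2 := (hloc 0 1).hasDerivAt_eq_zero (hd1 0 1 0)
    simp at h1 h2
    refine Prod.ext ?_ ?_
    · simp only [youngGrad]; linarith
    · simp only [youngGrad]; linarith
  · refine pairSum_nonneg_of_form_nonneg fun e₁ e₂ => ?_
    exact deriv_deriv_nonneg_of_isLocalMin (hloc e₁ e₂) (hd1 e₁ e₂) (hd2 e₁ e₂)

/-- Integral of the transported Gaussian integrand: lower bound, for one negative weight. -/
theorem le_lintegral_transport {a c : Fin 3 → ℝ} {T l : Fin 3 → ℝ → ℝ} {R : ℝ} (ha0 : a 0 < 0)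
    (ha1 : 0 < a 1) (ha2 : 0 < a 2) (hD : 0 < pairSum a)
    (hT : ∀ j x, HasDerivAt (T j) (l j x) x) (hlc : ∀ j, Continuous (l j)) (hl : ∀ x, l 0 x ≤ 1)
    (hR1 : ∀ x, |T 1 x - x| ≤ R) (hR2 : ∀ x, |T 2 x - x| ≤ R)
    (hdet : ∀ p, 0 ≤ (pairSum fun j => a j * l j (youngMap j p)) →
      (pairSum fun j => a j * l j (youngMap j p)) ≤ pairSum a * ∏ j, l j (youngMap j p) ^ c j) :
    ENNReal.ofReal (√(pairSum a))⁻¹ ≤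
    ∫⁻ p, ENNReal.ofReal ((∏ j, l j (youngMap j p) ^ c j) *
      Real.exp (-Real.pi * ∑ j, a j * T j (youngMap j p) ^ 2)) := by
  have ha : 0 < a 0 + a 2 := by
    unfold pairSum at hD
    by_contra! h
    nlinarith [mul_nonpos_of_nonpos_of_nonneg h ha1.le, mul_neg_of_neg_of_pos ha0 ha2]
  have hTc : ∀ j, Continuous (T j) := fun j =>
    continuous_iff_continuousAt.2 fun x => (hT j x).continuousAt
  have hΦc : Continuous (youngGrad a T) := by
    have h0 := hTc 0
    have h1 := hTc 1
    have h2 := hTc 2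
    unfold youngGrad
    fun_prop
  -- As a_0 < 0, the Jacobian may change sign. The part of the plane where it has the useful sign is
  -- already mapped onto everything.
  let S : Set (ℝ × ℝ) := {p | 0 ≤ pairSum fun j => a j * l j (youngMap j p)}
  have hSc : Continuous fun p : ℝ × ℝ => pairSum fun j => a j * l j (youngMap j p) := by
    have h0 := hlc 0
    have h1 := hlc 1
    have h2 := hlc 2
    simp only [pairSum, youngMap_zero, youngMap_one, youngMap_two]
    fun_prop
  have hS : MeasurableSet S := (isClosed_le continuous_const hSc).measurableSet
  have hcont : Continuous fun p => (youngGradDeriv a l p).det := by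
    simp_rw [det_youngGradDeriv]
    exact hSc.neg
  set w : ℝ × ℝ → ℝ≥0∞ := fun p => ENNReal.ofReal |(youngGradDeriv a l p).det| with hw
  have hwm : Measurable w := by
    have := hcont.measurable
    fun_prop
  -- The area inequality needs no injectivity: the measure of an image is at most the integral of
  -- the Jacobian.
  have hvol : (volume : Measure (ℝ × ℝ)) ≤
      ((volume.restrict S).withDensity w).map (youngGrad a T) := by
    refine Measure.le_iff.2 fun A hA => ?_
    rw [Measure.map_apply hΦc.measurable hA, withDensity_apply _ (hΦc.measurable hA),
      Measure.restrict_restrict (hΦc.measurable hA)]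
    have hsub : A ⊆ youngGrad a T '' (youngGrad a T ⁻¹' A ∩ S) := fun ξ hξ => by
      obtain ⟨p, hp, hp'⟩ := exists_youngGrad_eq ha0 ha1 ha2 hD hT hl hR1 hR2 ξ
      exact ⟨p, ⟨by rw [mem_preimage, hp]; exact hξ, hp'⟩, hp⟩
    exact (measure_mono hsub).trans (addHaar_image_le_lintegral_abs_det_fderiv volume
      ((hΦc.measurable hA).inter hS) fun p _ => (hasFDerivAt_youngGrad hT p).hasFDerivWithinAt)
  have key : ENNReal.ofReal √(pairSum a) ≤
      ENNReal.ofReal (pairSum a) * ∫⁻ p, ENNReal.ofReal ((∏ j, l j (youngMap j p) ^ c j) *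
      Real.exp (-Real.pi * ∑ j, a j * T j (youngMap j p) ^ 2)) := by
    rw [← lintegral_dualGaussian ha hD, ← lintegral_const_mul' _ _ ENNReal.ofReal_ne_top]
    calc _ ≤ _ := lintegral_mono' hvol le_rfl
      _ = ∫⁻ p in S, w p * ENNReal.ofReal (dualGaussian a (youngGrad a T p)) := by
          have hm : Measurable fun p => ENNReal.ofReal (dualGaussian a p) := by fun_prop
          rw [lintegral_map hm hΦc.measurable]
          exact lintegral_withDensity_eq_lintegral_mul _ hwm (hm.comp hΦc.measurable)
      _ ≤ ∫⁻ p in S, ENNReal.ofReal (pairSum a) *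
            ENNReal.ofReal ((∏ j, l j (youngMap j p) ^ c j) *
            Real.exp (-Real.pi * ∑ j, a j * T j (youngMap j p) ^ 2)) := by
          refine setLIntegral_mono' hS fun p hp => ?_
          rw [← ENNReal.ofReal_mul hD.le, hw, ← ENNReal.ofReal_mul (abs_nonneg _)]
          refine ENNReal.ofReal_le_ofReal ?_
          rw [← mul_assoc, det_youngGradDeriv, abs_neg, abs_of_nonneg hp]
          refine mul_le_mul (hdet p hp) ?_ (Real.exp_pos _).le (hp.trans (hdet p hp))
          refine Real.exp_le_exp.2 ?_
          rw [energy_eq hD.ne']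
          refine mul_le_mul_of_nonpos_left ?_ (neg_nonpos.2 Real.pi_pos.le)
          refine add_le_of_nonpos_right (mul_nonpos_of_nonpos_of_nonneg ?_ (sq_nonneg _))
          exact div_nonpos_of_nonpos_of_nonneg (mul_nonpos_of_nonpos_of_nonneg
            (mul_nonpos_of_nonpos_of_nonneg ha0.le ha1.le) ha2.le) hD.le
      _ ≤ _ := setLIntegral_le_lintegral _ _
  rw [← ENNReal.mul_le_mul_iff_right (ENNReal.ofReal_pos.2 hD).ne' ENNReal.ofReal_ne_top,
    ← ENNReal.ofReal_mul hD.le]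
  refine Eq.trans_le ?_ key
  congr 1
  rw [← div_eq_mul_inv, Real.div_sqrt]

/-! ### Determinant inequalities -/

/-- Weighted AM-GM for the products l_il_j with weights a_ia_j/D, which sum to 1. In the geometric
mean l_0 has exponent exactly c_0, while the exponents of l_1 and l_2 are at most c_1 and c_2; as
l_j ≤ 1, raising these exponents only decreases the product. -/
lemma mul_prod_rpow_le_pairSum {a c l : Fin 3 → ℝ} (ha : ∀ j, 0 < a j) (hl : ∀ j, 0 < l j)
    (hl1 : ∀ j, l j ≤ 1) (h0 : (1 - c 0) * pairSum a = a 1 * a 2)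
    (h1 : (1 - c 1) * pairSum a ≤ a 0 * a 2) (h2 : (1 - c 2) * pairSum a ≤ a 0 * a 1) :
    pairSum a * ∏ j, l j ^ c j ≤ pairSum fun j => a j * l j := by
  have := ha 0; have := ha 1; have := ha 2
  have hD : 0 < pairSum a := by unfold pairSum; positivity
  have hl0 := hl 0; have hl1' := hl 1; have hl2 := hl 2
  have amgm := Real.geom_mean_le_arith_mean3_weighted (w₁ := a 0 * a 1 / pairSum a)
    (w₂ := a 0 * a 2 / pairSum a) (w₃ := a 1 * a 2 / pairSum a) (p₁ := l 0 * l 1)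
    (p₂ := l 0 * l 2) (p₃ := l 1 * l 2) (by positivity) (by positivity) (by positivity)
    (by positivity) (by positivity) (by positivity)
    (by rw [← add_div, ← add_div]; exact div_self hD.ne')
  have e3 : a 1 * a 2 / pairSum a = 1 - c 0 := by rw [← h0]; field_simp
  have e0 : a 0 * a 1 / pairSum a + a 0 * a 2 / pairSum a = c 0 := by
    have : a 0 * a 1 / pairSum a + a 0 * a 2 / pairSum a + a 1 * a 2 / pairSum a = 1 := by
      rw [← add_div, ← add_div]; exact div_self hD.ne'
    linarith
  have e1 : a 0 * a 1 / pairSum a + a 1 * a 2 / pairSum a ≤ c 1 := by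
    have : 1 - c 1 ≤ a 0 * a 2 / pairSum a := by rwa [le_div_iff₀ hD]
    linarith
  have e2 : a 0 * a 2 / pairSum a + a 1 * a 2 / pairSum a ≤ c 2 := by
    have : 1 - c 2 ≤ a 0 * a 1 / pairSum a := by rwa [le_div_iff₀ hD]
    linarith
  have hgeom : ∏ j, l j ^ c j ≤ (l 0 * l 1) ^ (a 0 * a 1 / pairSum a) *
      (l 0 * l 2) ^ (a 0 * a 2 / pairSum a) * (l 1 * l 2) ^ (a 1 * a 2 / pairSum a) := by
    rw [Fin.prod_univ_three]
    calc _ ≤ l 0 ^ (a 0 * a 1 / pairSum a + a 0 * a 2 / pairSum a) *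
          l 1 ^ (a 0 * a 1 / pairSum a + a 1 * a 2 / pairSum a) *
          l 2 ^ (a 0 * a 2 / pairSum a + a 1 * a 2 / pairSum a) := by
          rw [e0]
          refine mul_le_mul (mul_le_mul_of_nonneg_left ?_ (by positivity)) ?_ (by positivity)
            (by positivity)
          · exact Real.rpow_le_rpow_of_exponent_ge hl1' (hl1 1) e1
          · exact Real.rpow_le_rpow_of_exponent_ge hl2 (hl1 2) e2
      _ = _ := by
          rw [Real.mul_rpow hl0.le hl1'.le, Real.mul_rpow hl0.le hl2.le,
            Real.mul_rpow hl1'.le hl2.le, Real.rpow_add hl0, Real.rpow_add hl1', Real.rpow_add hl2]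
          ring
  calc _ ≤ pairSum a * _ := mul_le_mul_of_nonneg_left (hgeom.trans amgm) hD.le
    _ = _ := by
      field_simp
      unfold pairSum
      ring

/-- With a_0 < 0, moving the two negative terms across writes l_1l_2 as a weighted mean of X, l_0l_1
and l_0l_2, where X is the quotient of the determinants. AM-GM then bounds X from above; taking
logarithms, l_j ≤ 1 again absorbs the slack in the exponents of l_1 and l_2. -/
lemma pairSum_le_mul_prod_rpow {a c l : Fin 3 → ℝ} (ha0 : a 0 < 0) (ha1 : 0 < a 1)
    (ha2 : 0 < a 2) (hD : 0 < pairSum a) (hl : ∀ j, 0 < l j)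
    (hl1 : ∀ j, l j ≤ 1) (h0 : (1 - c 0) * pairSum a = a 1 * a 2)
    (h1 : a 0 * a 2 ≤ (1 - c 1) * pairSum a) (h2 : a 0 * a 1 ≤ (1 - c 2) * pairSum a)
    (hnn : 0 ≤ pairSum fun j => a j * l j) :
    (pairSum fun j => a j * l j) ≤ pairSum a * ∏ j, l j ^ c j := by
  have hl0 := hl 0; have hl1' := hl 1; have hl2 := hl 2
  have hprod : 0 < ∏ j, l j ^ c j := Finset.prod_pos fun j _ => Real.rpow_pos_of_pos (hl j) _
  -- The logarithm of X requires X > 0; a vanishing determinant is trivial.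
  rcases hnn.eq_or_lt with hz | hpos
  · rw [← hz]; positivity
  set X := (pairSum fun j => a j * l j) / pairSum a with hX
  have hX0 : 0 < X := div_pos hpos hD
  have h12 : 0 < a 1 * a 2 := mul_pos ha1 ha2
  have hq : 0 < -(a 0 * a 1) := by nlinarith
  have hr : 0 < -(a 0 * a 2) := by nlinarith
  have amgm := Real.geom_mean_le_arith_mean3_weighted (w₁ := pairSum a / (a 1 * a 2))
    (w₂ := -(a 0 * a 1) / (a 1 * a 2)) (w₃ := -(a 0 * a 2) / (a 1 * a 2)) (p₁ := X)
    (p₂ := l 0 * l 1) (p₃ := l 0 * l 2) (by positivity) (by positivity) (by positivity)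
    (by positivity) (by positivity) (by positivity)
    (by rw [← add_div, ← add_div, div_eq_one_iff_eq h12.ne']; unfold pairSum; ring)
  have e : pairSum a / (a 1 * a 2) * X + -(a 0 * a 1) / (a 1 * a 2) * (l 0 * l 1) +
      -(a 0 * a 2) / (a 1 * a 2) * (l 0 * l 2) = l 1 * l 2 := by
    rw [hX]
    field_simp
    unfold pairSum
    ring
  rw [e] at amgm
  have hlog := Real.log_le_log (by positivity) amgm
  rw [Real.log_mul (by positivity) (by positivity), Real.log_mul (by positivity) (by positivity),
    Real.log_rpow hX0, Real.log_rpow (by positivity), Real.log_rpow (by positivity),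
    Real.log_mul hl0.ne' hl1'.ne', Real.log_mul hl0.ne' hl2.ne', Real.log_mul hl1'.ne' hl2.ne']
    at hlog
  have hlog2 : pairSum a * Real.log X ≤ pairSum a * ∑ j, c j * Real.log (l j) := by
    rw [Fin.sum_univ_three]
    have n1 := Real.log_nonpos hl1'.le (hl1 1)
    have n2 := Real.log_nonpos hl2.le (hl1 2)
    have k := mul_le_mul_of_nonneg_left hlog h12.le
    have k' : pairSum a * Real.log X + -(a 0 * a 1) * (Real.log (l 0) + Real.log (l 1)) +
        -(a 0 * a 2) * (Real.log (l 0) + Real.log (l 2)) ≤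
        a 1 * a 2 * (Real.log (l 1) + Real.log (l 2)) := by
      refine Eq.trans_le ?_ k
      field_simp
    have k1 := mul_le_mul_of_nonpos_right h1 n1
    have k2 := mul_le_mul_of_nonpos_right h2 n2
    have e0 : c 0 * pairSum a = a 0 * a 1 + a 0 * a 2 := by
      have : pairSum a = a 0 * a 1 + a 0 * a 2 + a 1 * a 2 := rfl
      linarith
    have e0' : pairSum a * (c 0 * Real.log (l 0)) = (a 0 * a 1 + a 0 * a 2) * Real.log (l 0) := by
      rw [← e0]; ring
    have e1 : pairSum a * Real.log (l 1) = (a 0 * a 1 + a 0 * a 2 + a 1 * a 2) * Real.log (l 1) :=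
      rfl
    have e2 : pairSum a * Real.log (l 2) = (a 0 * a 1 + a 0 * a 2 + a 1 * a 2) * Real.log (l 2) :=
      rfl
    linarith
  have hlog3 : Real.log X ≤ Real.log (∏ j, l j ^ c j) := by
    rw [Real.log_prod (fun j _ => (Real.rpow_pos_of_pos (hl j) _).ne')]
    simp_rw [fun j => Real.log_rpow (hl j) (c j)]
    exact le_of_mul_le_mul_left hlog2 hD
  have := (Real.log_le_log_iff hX0 hprod).1 hlog3
  rw [hX, div_le_iff₀ hD] at this
  linarith

/-! ### The functional in transport coordinates -/

section Functional

variable {c σ : Fin 3 → ℝ}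

lemma gaussian_youngG (j : Fin 3) (x : ℝ) :
    gaussian (youngG σ j) x = normalDensity (σ j) x := by
  have h : LinearMap.det (youngG σ j) = (σ j)⁻¹ := by
    simp [youngG]
  unfold gaussian normalDensity
  rw [h, ← Real.sqrt_eq_rpow, Real.sqrt_inv]
  congr 2
  simp [youngG]
  ring

lemma gaussianConv_youngG (j : Fin 3) (μ : Measure ℝ) (x : ℝ) :
    gaussianConv (youngG σ j) μ x = ∫⁻ y, ENNReal.ofReal (normalDensity (σ j) (x - y)) ∂μ := by
  simp_rw [gaussianConv, gaussian_youngG]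

lemma gaussianConv_youngG_eq_ofReal {j : Fin 3} (hσ : 0 < σ j) (μ : Measure ℝ) [IsFiniteMeasure μ]
    (x : ℝ) : gaussianConv (youngG σ j) μ x =
      ENNReal.ofReal (∫ y, normalDensity (σ j) (x - y) ∂μ) := by
  rw [gaussianConv_youngG, ofReal_integral_eq_lintegral_ofReal
    (integrable_normalDensity_sub μ hσ x) (ae_of_all _ fun y => (normalDensity_pos hσ _).le)]

lemma lintegral_gaussianConv_youngG {j : Fin 3} (hσ : 0 < σ j) (μ : Measure ℝ)
    [IsFiniteMeasure μ] : ∫⁻ x, gaussianConv (youngG σ j) μ x = μ univ := by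
  simp_rw [gaussianConv_youngG]
  rw [lintegral_lintegral_swap (by fun_prop)]
  have h : ∀ y : ℝ, ∫⁻ x, ENNReal.ofReal (normalDensity (σ j) (x - y)) = 1 := fun y => by
    rw [lintegral_sub_right_eq_self (fun x => ENNReal.ofReal (normalDensity (σ j) x)) y,
      lintegral_normalDensity hσ]
  simp [h]

/-- The functional of the Young datum in terms of transport maps to normal densities. -/
lemma functional_youngMap_eq (hσ : ∀ j, 0 < σ j) {m : Fin 3 → ℝ} (hm : ∀ j, 0 < m j)
    {f : Fin 3 → ℝ → ℝ≥0∞} {T l : Fin 3 → ℝ → ℝ} (hl : ∀ j x, 0 < l j x)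
    (hf : ∀ j x, f j x = ENNReal.ofReal (m j * l j x * normalDensity (σ j) (T j x)))
    (hint : ∀ j, ∫⁻ x, f j x = ENNReal.ofReal (m j)) :
    functional (E := fun _ : Fin 3 => ℝ) youngMap c f =
      ENNReal.ofReal (√(∏ j, σ j ^ c j))⁻¹ *
      ∫⁻ p, ENNReal.ofReal ((∏ j, l j (youngMap j p) ^ c j) *
        Real.exp (-Real.pi * ∑ j, c j / σ j * T j (youngMap j p) ^ 2)) := by
  have hM : 0 < ∏ j, m j ^ c j := Finset.prod_pos fun j _ => Real.rpow_pos_of_pos (hm j) _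
  have hg : ∀ j x, normalDensity (σ j) x ^ c j =
      (√(σ j ^ c j))⁻¹ * Real.exp (-Real.pi * (c j / σ j * x ^ 2)) := fun j x => by
    unfold normalDensity
    rw [Real.mul_rpow (by positivity) (Real.exp_pos _).le, ← Real.exp_mul,
      Real.inv_rpow (Real.sqrt_nonneg _), Real.sqrt_eq_rpow, Real.sqrt_eq_rpow,
      ← Real.rpow_mul (hσ j).le, ← Real.rpow_mul (hσ j).le, mul_comm (c j)]
    congr 2
    ring
  have hs : √(∏ j, σ j ^ c j) = ∏ j, √(σ j ^ c j) := by
    have h (j) : 0 ≤ σ j ^ c j := Real.rpow_nonneg (hσ j).le _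
    rw [Fin.prod_univ_three, Fin.prod_univ_three, Real.sqrt_mul (mul_nonneg (h 0) (h 1)),
      Real.sqrt_mul (h 0)]
  have hpt : ∀ p : ℝ × ℝ, ∏ j, f j (youngMap j p) ^ c j =
      ENNReal.ofReal ((∏ j, m j ^ c j) * (√(∏ j, σ j ^ c j))⁻¹) *
      ENNReal.ofReal ((∏ j, l j (youngMap j p) ^ c j) *
        Real.exp (-Real.pi * ∑ j, c j / σ j * T j (youngMap j p) ^ 2)) := fun p => by
    have h1 : ∀ j, f j (youngMap j p) ^ c j = ENNReal.ofReal (m j ^ c j *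
        l j (youngMap j p) ^ c j * ((√(σ j ^ c j))⁻¹ *
        Real.exp (-Real.pi * (c j / σ j * T j (youngMap j p) ^ 2)))) := fun j => by
      have p1 := mul_pos (hm j) (hl j (youngMap j p))
      have p2 := normalDensity_pos (hσ j) (T j (youngMap j p))
      rw [hf, ENNReal.ofReal_rpow_of_pos (mul_pos p1 p2), Real.mul_rpow p1.le p2.le,
        Real.mul_rpow (hm j).le (hl j _).le, hg]
    simp_rw [h1]
    rw [← ENNReal.ofReal_prod_of_nonneg, ← ENNReal.ofReal_mul (by positivity)]
    · congr 1
      rw [hs, Finset.mul_sum, Real.exp_sum]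
      simp_rw [Finset.prod_mul_distrib, Finset.prod_inv_distrib]
      ring
    · intro j _
      have := Real.rpow_pos_of_pos (hm j) (c j)
      have := Real.rpow_pos_of_pos (hl j (youngMap j p)) (c j)
      positivity
  have hden : ∏ j, (∫⁻ y, f j y) ^ c j = ENNReal.ofReal (∏ j, m j ^ c j) := by
    simp_rw [hint, fun j => ENNReal.ofReal_rpow_of_pos (p := c j) (hm j)]
    rw [← ENNReal.ofReal_prod_of_nonneg fun j _ => (Real.rpow_pos_of_pos (hm j) _).le]
  unfold functional
  rw [hden]
  simp_rw [hpt]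
  rw [lintegral_const_mul' _ _ ENNReal.ofReal_ne_top, ENNReal.ofReal_mul hM.le,
    mul_assoc, mul_comm, mul_div_assoc]
  rw [ENNReal.div_self (ENNReal.ofReal_pos.2 hM).ne' ENNReal.ofReal_ne_top, mul_one]

end Functional

/-! ### Normal densities as test functions, and the constant -/

section Constants

variable {c σ : Fin 3 → ℝ}

/-- The inverse square of the value of the Young functional at normal densities of
variances `v j`. -/
noncomputable def gaussianEnergy (c v : Fin 3 → ℝ) : ℝ :=
  (∏ j, v j ^ c j) * pairSum fun j => c j / v j

lemma functional_normalDensity {v : Fin 3 → ℝ} (hv : ∀ j, 0 < v j)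
    (h12 : 0 < c 1 / v 1 + c 2 / v 2) (hD : 0 < pairSum fun j => c j / v j) :
    functional (E := fun _ : Fin 3 => ℝ) youngMap c
      (fun j x => ENNReal.ofReal (normalDensity (v j) x)) =
      ENNReal.ofReal (√(gaussianEnergy c v))⁻¹ := by
  rw [functional_youngMap_eq hv (m := fun _ => 1) (fun _ => one_pos) (T := fun _ x => x)
    (l := fun _ _ => 1) (fun _ _ => one_pos) (by simp)
    (fun j => by rw [lintegral_normalDensity (hv j), ENNReal.ofReal_one])]
  have h := lintegral_exp_quadratic (b := fun j => c j / v j) h12 hD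
  have e : ∀ p : ℝ × ℝ, (∏ j, (1 : ℝ) ^ c j) *
      Real.exp (-Real.pi * ∑ j, c j / v j * youngMap j p ^ 2) =
      Real.exp (-Real.pi * (c 0 / v 0 * p.1 ^ 2 + c 1 / v 1 * p.2 ^ 2 +
        c 2 / v 2 * (p.1 - p.2) ^ 2)) := fun p => by
    simp [Fin.sum_univ_three]
  simp_rw [e]
  have hP : 0 < ∏ j, v j ^ c j := Finset.prod_pos fun j _ => Real.rpow_pos_of_pos (hv j) _
  rw [h, ← ENNReal.ofReal_mul (by positivity), ← mul_inv, ← Real.sqrt_mul hP.le, gaussianEnergy]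

lemma normalDensity_mem_typeClass {v : ℝ} {j : Fin 3} (hσ : 0 < σ j) (hv : σ j ≤ v) :
    (fun x => ENNReal.ofReal (normalDensity v x)) ∈ typeClass (youngG σ j) := by
  -- Variance σ_j itself comes from a Dirac mass, a larger variance v from the normal law of
  -- variance v - σ_j.
  rcases hv.eq_or_lt with rfl | hlt
  · refine ⟨Measure.dirac 0, inferInstance, Measure.dirac_ne_zero, ?_⟩
    funext x
    simp [gaussianConv_youngG]
  · have hτ : 0 < v - σ j := sub_pos.2 hlt
    refine ⟨volume.withDensity fun y => ENNReal.ofReal (normalDensity (v - σ j) y), ⟨?_⟩, ?_, ?_⟩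
    · rw [withDensity_apply _ MeasurableSet.univ, setLIntegral_univ, lintegral_normalDensity hτ]
      exact ENNReal.one_lt_top
    · intro h
      have h2 := withDensity_apply (μ := volume)
        (fun y => ENNReal.ofReal (normalDensity (v - σ j) y)) MeasurableSet.univ
      rw [setLIntegral_univ, lintegral_normalDensity hτ, h] at h2
      simp at h2
    · funext x
      rw [gaussianConv_youngG, lintegral_normalDensity_sub_withDensity hσ hτ, add_sub_cancel]

/-- The hypothesis on σ in the form used everywhere below: it fixes the exponent of l_0 in the AM-GM
steps. -/
lemma one_sub_mul_pairSum (hc0 : c 0 < 1) (hc1 : 0 < c 1) (hc2 : 0 < c 2) (hσ : ∀ j, 0 < σ j)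
    (hcσ : σ 0 / (1 - c 0) = σ 1 / c 1 + σ 2 / c 2) :
    (1 - c 0) * (pairSum fun j => c j / σ j) = c 1 / σ 1 * (c 2 / σ 2) := by
  have h0 := hσ 0; have h1 := hσ 1; have h2 := hσ 2
  have hc0' : 0 < 1 - c 0 := sub_pos.2 hc0
  have e : σ 0 = (1 - c 0) * (σ 1 / c 1 + σ 2 / c 2) := by rw [← hcσ]; field_simp
  have e2 : c 0 / σ 0 * (c 1 / σ 1 + c 2 / σ 2) * (1 - c 0) = c 0 * (c 1 / σ 1 * (c 2 / σ 2)) := by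
    rw [e]; field_simp; ring
  unfold pairSum
  linarith

lemma pairSum_div_pos (hc0 : c 0 < 1) (hc1 : 0 < c 1) (hc2 : 0 < c 2) (hσ : ∀ j, 0 < σ j)
    (hcσ : σ 0 / (1 - c 0) = σ 1 / c 1 + σ 2 / c 2) : 0 < pairSum fun j => c j / σ j := by
  have h := one_sub_mul_pairSum hc0 hc1 hc2 hσ hcσ
  have : 0 < c 1 / σ 1 * (c 2 / σ 2) := mul_pos (div_pos hc1 (hσ 1)) (div_pos hc2 (hσ 2))
  rw [← h] at this
  exact pos_of_mul_pos_right this (sub_pos.2 hc0).le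

lemma tildeA_mul_div_eq (hc0 : c 0 < 1) (hc1 : 0 < c 1) (hc2 : 0 < c 2) (hσ : ∀ j, 0 < σ j)
    (hcσ : σ 0 / (1 - c 0) = σ 1 / c 1 + σ 2 / c 2) :
    tildeA (c 1) (σ 1) * tildeA (c 2) (σ 2) / tildeA (1 - c 0) (σ 0) =
      (√(gaussianEnergy c σ))⁻¹ := by
  have h0 := hσ 0; have h1 := hσ 1; have h2 := hσ 2
  have hc0' : 0 < 1 - c 0 := sub_pos.2 hc0
  have hD : (pairSum fun j => c j / σ j) = c 1 / σ 1 * (c 2 / σ 2) / (1 - c 0) := by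
    rw [← one_sub_mul_pairSum hc0 hc1 hc2 hσ hcσ]; field_simp
  have p0 := Real.rpow_pos_of_pos h0 (c 0)
  have p1 := Real.rpow_pos_of_pos h1 (c 1)
  have p2 := Real.rpow_pos_of_pos h2 (c 2)
  simp only [tildeA, ← Real.sqrt_eq_rpow, gaussianEnergy, hD, Fin.prod_univ_three]
  rw [← Real.sqrt_inv, ← Real.sqrt_mul, ← Real.sqrt_div, Real.rpow_sub h1, Real.rpow_sub h2,
    sub_sub_cancel, Real.rpow_one, Real.rpow_one]
  · congr 1
    field_simp
  · rw [Real.rpow_sub h1, Real.rpow_sub h2, Real.rpow_one, Real.rpow_one]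
    positivity
  · rw [Real.rpow_sub h1, Real.rpow_one]
    positivity

/-- Multiply each difference by D and replace (1-c_0)D by a_1a_2; a positive factor a_1 or a_2 then
splits off. -/
lemma le_iff_one_sub_mul_pairSum_le {a c : Fin 3 → ℝ} (ha1 : 0 < a 1) (ha2 : 0 < a 2)
    (hD : 0 < pairSum a) (h0 : (1 - c 0) * pairSum a = a 1 * a 2) :
    (((1 - c 1) * a 1 ≤ (1 - c 0) * a 0 ↔ (1 - c 1) * pairSum a ≤ a 0 * a 2) ∧
    ((1 - c 2) * a 2 ≤ (1 - c 0) * a 0 ↔ (1 - c 2) * pairSum a ≤ a 0 * a 1)) ∧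
    (((1 - c 0) * a 0 ≤ (1 - c 1) * a 1 ↔ a 0 * a 2 ≤ (1 - c 1) * pairSum a) ∧
    ((1 - c 0) * a 0 ≤ (1 - c 2) * a 2 ↔ a 0 * a 1 ≤ (1 - c 2) * pairSum a)) := by
  have e1 : ((1 - c 0) * a 0 - (1 - c 1) * a 1) * pairSum a =
      (a 0 * a 2 - (1 - c 1) * pairSum a) * a 1 := by linear_combination a 0 * h0
  have e2 : ((1 - c 0) * a 0 - (1 - c 2) * a 2) * pairSum a =
      (a 0 * a 1 - (1 - c 2) * pairSum a) * a 2 := by linear_combination a 0 * h0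
  have e3 : ((1 - c 1) * a 1 - (1 - c 0) * a 0) * pairSum a =
      ((1 - c 1) * pairSum a - a 0 * a 2) * a 1 := by linear_combination -e1
  have e4 : ((1 - c 2) * a 2 - (1 - c 0) * a 0) * pairSum a =
      ((1 - c 2) * pairSum a - a 0 * a 1) * a 2 := by linear_combination -e2
  refine ⟨⟨?_, ?_⟩, ?_, ?_⟩
  · rw [← sub_nonneg, ← mul_nonneg_iff_of_pos_right hD, e1, mul_nonneg_iff_of_pos_right ha1,
      sub_nonneg]
  · rw [← sub_nonneg, ← mul_nonneg_iff_of_pos_right hD, e2, mul_nonneg_iff_of_pos_right ha2,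
      sub_nonneg]
  · rw [← sub_nonneg, ← mul_nonneg_iff_of_pos_right hD, e3, mul_nonneg_iff_of_pos_right ha1,
      sub_nonneg]
  · rw [← sub_nonneg, ← mul_nonneg_iff_of_pos_right hD, e4, mul_nonneg_iff_of_pos_right ha2,
      sub_nonneg]

end Constants

/-! ### Necessity: first variation in the variances -/

section Necessity

/-- The conclusion is the derivative at v₀ divided by the positive factor v₀^(c-1). Only t > v₀ is
available, because variances below σ_j are not admissible. -/
lemma nonneg_of_eventually_rpow_mul_le {α β c v₀ : ℝ} (hv : 0 < v₀)
    (h : ∀ᶠ t in 𝓝[>] v₀, v₀ ^ c * (α + β * (c / v₀)) ≤ t ^ c * (α + β * (c / t))) :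
    0 ≤ c * α + (c - 1) * (β * (c / v₀)) := by
  have hd : HasDerivAt (fun t => t ^ c * (α + β * (c / t)))
      (c * v₀ ^ (c - 1) * (α + β * (c / v₀)) + v₀ ^ c * (β * (c * -(v₀ ^ 2)⁻¹))) v₀ :=
    (Real.hasDerivAt_rpow_const (Or.inl hv.ne')).mul
      ((((hasDerivAt_inv hv.ne').const_mul c).const_mul β).const_add α)
  have hnn : 0 ≤ c * v₀ ^ (c - 1) * (α + β * (c / v₀)) + v₀ ^ c * (β * (c * -(v₀ ^ 2)⁻¹)) := by
    refine ge_of_tendsto (hd.tendsto_slope.mono_left (nhdsGT_le_nhdsNE v₀)) ?_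
    filter_upwards [h, self_mem_nhdsWithin] with t ht hlt
    rw [slope_def_field]
    exact div_nonneg (sub_nonneg.2 ht) (sub_nonneg.2 (le_of_lt hlt))
  have e : c * v₀ ^ (c - 1) * (α + β * (c / v₀)) + v₀ ^ c * (β * (c * -(v₀ ^ 2)⁻¹)) =
      v₀ ^ (c - 1) * (c * α + (c - 1) * (β * (c / v₀))) := by
    rw [Real.rpow_sub hv, Real.rpow_one]
    field_simp
    ring
  rw [e] at hnn
  exact nonneg_of_mul_nonneg_right hnn (Real.rpow_pos_of_pos hv _)

variable {c σ : Fin 3 → ℝ}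

lemma gaussianEnergy_update_one (t : ℝ) :
    gaussianEnergy c (Function.update σ 1 t) = σ 0 ^ c 0 * σ 2 ^ c 2 *
      (t ^ c 1 * (c 0 / σ 0 * (c 2 / σ 2) + (c 0 / σ 0 + c 2 / σ 2) * (c 1 / t))) := by
  simp [gaussianEnergy, pairSum, Fin.prod_univ_three, Function.update]
  ring

lemma gaussianEnergy_update_two (t : ℝ) :
    gaussianEnergy c (Function.update σ 2 t) = σ 0 ^ c 0 * σ 1 ^ c 1 *
      (t ^ c 2 * (c 0 / σ 0 * (c 1 / σ 1) + (c 0 / σ 0 + c 1 / σ 1) * (c 2 / t))) := by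
  simp [gaussianEnergy, pairSum, Fin.prod_univ_three, Function.update]
  ring

lemma one_sub_mul_pairSum_le_of_energy_le (hσ : ∀ j, 0 < σ j)
    (h : ∀ j, ∀ᶠ t in 𝓝[>] σ j, gaussianEnergy c σ ≤ gaussianEnergy c (Function.update σ j t)) :
    (1 - c 1) * (pairSum fun j => c j / σ j) ≤ c 0 / σ 0 * (c 2 / σ 2) ∧
    (1 - c 2) * (pairSum fun j => c j / σ j) ≤ c 0 / σ 0 * (c 1 / σ 1) := by
  have h0 := hσ 0; have h1 := hσ 1; have h2 := hσ 2
  constructor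
  · have k := h 1
    rw [show gaussianEnergy c σ = gaussianEnergy c (Function.update σ 1 (σ 1)) by simp] at k
    simp_rw [gaussianEnergy_update_one] at k
    have := nonneg_of_eventually_rpow_mul_le h1
      (k.mono fun t ht => le_of_mul_le_mul_left ht (by positivity))
    unfold pairSum
    linarith
  · have k := h 2
    rw [show gaussianEnergy c σ = gaussianEnergy c (Function.update σ 2 (σ 2)) by simp] at k
    simp_rw [gaussianEnergy_update_two] at k
    have := nonneg_of_eventually_rpow_mul_le h2
      (k.mono fun t ht => le_of_mul_le_mul_left ht (by positivity))
    unfold pairSum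
    linarith

lemma le_one_sub_mul_pairSum_of_le_energy (hσ : ∀ j, 0 < σ j)
    (h : ∀ j, ∀ᶠ t in 𝓝[>] σ j, gaussianEnergy c (Function.update σ j t) ≤ gaussianEnergy c σ) :
    c 0 / σ 0 * (c 2 / σ 2) ≤ (1 - c 1) * (pairSum fun j => c j / σ j) ∧
    c 0 / σ 0 * (c 1 / σ 1) ≤ (1 - c 2) * (pairSum fun j => c j / σ j) := by
  have h0 := hσ 0; have h1 := hσ 1; have h2 := hσ 2
  constructor
  · have k := h 1
    rw [show gaussianEnergy c σ = gaussianEnergy c (Function.update σ 1 (σ 1)) by simp] at k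
    simp_rw [gaussianEnergy_update_one] at k
    -- Negating α and β turns the local maximum from the right into a local minimum.
    have := nonneg_of_eventually_rpow_mul_le (α := -(c 0 / σ 0 * (c 2 / σ 2)))
      (β := -(c 0 / σ 0 + c 2 / σ 2)) (c := c 1) h1
      (k.mono fun t ht => by linarith [le_of_mul_le_mul_left ht (by positivity)])
    unfold pairSum
    linarith
  · have k := h 2
    rw [show gaussianEnergy c σ = gaussianEnergy c (Function.update σ 2 (σ 2)) by simp] at k
    simp_rw [gaussianEnergy_update_two] at k
    have := nonneg_of_eventually_rpow_mul_le (α := -(c 0 / σ 0 * (c 1 / σ 1)))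
      (β := -(c 0 / σ 0 + c 1 / σ 1)) (c := c 2) h2
      (k.mono fun t ht => by linarith [le_of_mul_le_mul_left ht (by positivity)])
    unfold pairSum
    linarith

/-- Near `σ`, normal densities with one larger variance are admissible test functions. -/
lemma eventually_functional_update (hc1 : 0 < c 1) (hc2 : 0 < c 2) (hσ : ∀ j, 0 < σ j)
    (hD : 0 < pairSum fun j => c j / σ j) (i : Fin 3) :
    ∀ᶠ t in 𝓝[>] σ i, 0 < gaussianEnergy c (Function.update σ i t) ∧
      ∃ f : Fin 3 → ℝ → ℝ≥0∞, (∀ j, f j ∈ typeClass (youngG σ j)) ∧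
        functional (E := fun _ : Fin 3 => ℝ) youngMap c f =
          ENNReal.ofReal (√(gaussianEnergy c (Function.update σ i t)))⁻¹ := by
  have hcont : ContinuousAt (fun t => pairSum fun j => c j / Function.update σ i t j) (σ i) := by
    have : ∀ j, ContinuousAt (fun t => c j / Function.update σ i t j) (σ i) := fun j => by
      refine continuousAt_const.div ?_ (by simpa using (hσ j).ne')
      have h : Continuous fun t => Function.update σ i t :=
        continuous_const.update i continuous_id
      exact ((continuous_apply j).comp h).continuousAt
    unfold pairSum
    exact (((this 0).mul (this 1)).add ((this 0).mul (this 2))).add ((this 1).mul (this 2))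
  -- The perturbed form must stay positive definite for its Gaussian integral to be finite; this
  -- persists near σ_i by continuity.
  have hev : ∀ᶠ t in 𝓝[>] σ i, 0 < pairSum fun j => c j / Function.update σ i t j :=
    nhdsWithin_le_nhds (hcont.eventually (lt_mem_nhds (by simpa using hD)))
  filter_upwards [hev, self_mem_nhdsWithin] with t ht hlt
  have hle : ∀ j, σ j ≤ Function.update σ i t j := fun j => by
    rcases eq_or_ne j i with rfl | hj
    · simpa using le_of_lt hlt
    · simp [hj]
  have hv : ∀ j, 0 < Function.update σ i t j := fun j => (hσ j).trans_le (hle j)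
  refine ⟨mul_pos (Finset.prod_pos fun j _ => Real.rpow_pos_of_pos (hv j) _) ht,
    fun j x => ENNReal.ofReal (normalDensity (Function.update σ i t j) x),
    fun j => normalDensity_mem_typeClass (hσ j) (hle j),
    functional_normalDensity hv (add_pos (div_pos hc1 (hv 1)) (div_pos hc2 (hv 2))) ht⟩

end Necessity

/-! ### Sufficiency: transport bounds and truncation -/

section Sufficiency

variable {c σ : Fin 3 → ℝ}

lemma ofReal_inv_sqrt_gaussianEnergy (hσ : ∀ j, 0 < σ j) :
    ENNReal.ofReal (√(gaussianEnergy c σ))⁻¹ = ENNReal.ofReal (√(∏ j, σ j ^ c j))⁻¹ *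
      ENNReal.ofReal (√(pairSum fun j => c j / σ j))⁻¹ := by
  have hP : 0 < ∏ j, σ j ^ c j := Finset.prod_pos fun j _ => Real.rpow_pos_of_pos (hσ j) _
  rw [gaussianEnergy, Real.sqrt_mul hP.le, mul_inv, ENNReal.ofReal_mul (by positivity)]

theorem functional_le (hc : ∀ j, 0 < c j) (hσ : ∀ j, 0 < σ j)
    (h0 : (1 - c 0) * (pairSum fun j => c j / σ j) = c 1 / σ 1 * (c 2 / σ 2))
    (h1 : (1 - c 1) * (pairSum fun j => c j / σ j) ≤ c 0 / σ 0 * (c 2 / σ 2))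
    (h2 : (1 - c 2) * (pairSum fun j => c j / σ j) ≤ c 0 / σ 0 * (c 1 / σ 1))
    {f : Fin 3 → ℝ → ℝ≥0∞} (hf : ∀ j, f j ∈ typeClass (youngG σ j)) :
    functional (E := fun _ : Fin 3 => ℝ) youngMap c f ≤
      ENNReal.ofReal (√(gaussianEnergy c σ))⁻¹ := by
  choose μ hμ hμ0 hfμ using hf
  have hμ1 : ∀ j, NeZero (μ j) := fun j => ⟨hμ0 j⟩
  choose T l hT _ using fun j => exists_normalTransport (μ j) (hσ j)
  have ha : ∀ j, 0 < c j / σ j := fun j => div_pos (hc j) (hσ j)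
  rw [functional_youngMap_eq hσ (fun j => measureReal_univ_pos_of_neZero (μ j))
    (fun j => (hT j).deriv_pos)
    (fun j x => by rw [hfμ, gaussianConv_youngG_eq_ofReal (hσ j), ← (hT j).eq])
    (fun j => by rw [hfμ, lintegral_gaussianConv_youngG (hσ j), ofReal_measureReal]),
    ofReal_inv_sqrt_gaussianEnergy hσ]
  gcongr
  exact lintegral_transport_le ha (fun j => (hT j).hasDerivAt) (fun j => (hT j).deriv_pos)
    fun p => mul_prod_rpow_le_pairSum ha (fun j => (hT j).deriv_pos _)
      (fun j => (hT j).deriv_le_one _) h0 h1 h2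

theorem le_functional_of_bounded_support (hc0 : c 0 < 0) (hc1 : 0 < c 1) (hc2 : 0 < c 2)
    (hσ : ∀ j, 0 < σ j) (hD : 0 < pairSum fun j => c j / σ j)
    (h0 : (1 - c 0) * (pairSum fun j => c j / σ j) = c 1 / σ 1 * (c 2 / σ 2))
    (h1 : c 0 / σ 0 * (c 2 / σ 2) ≤ (1 - c 1) * (pairSum fun j => c j / σ j))
    (h2 : c 0 / σ 0 * (c 1 / σ 1) ≤ (1 - c 2) * (pairSum fun j => c j / σ j))
    (μ : Fin 3 → Measure ℝ) [∀ j, IsFiniteMeasure (μ j)] [∀ j, NeZero (μ j)] {R : ℝ}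
    (hR1 : μ 1 (Icc (-R) R)ᶜ = 0) (hR2 : μ 2 (Icc (-R) R)ᶜ = 0) :
    ENNReal.ofReal (√(gaussianEnergy c σ))⁻¹ ≤
      functional (E := fun _ : Fin 3 => ℝ) youngMap c fun j => gaussianConv (youngG σ j) (μ j) := by
  choose T l hT hTR using fun j => exists_normalTransport (μ j) (hσ j)
  rw [functional_youngMap_eq hσ (fun j => measureReal_univ_pos_of_neZero (μ j))
    (fun j => (hT j).deriv_pos)
    (fun j x => by rw [gaussianConv_youngG_eq_ofReal (hσ j), ← (hT j).eq])
    (fun j => by rw [lintegral_gaussianConv_youngG (hσ j), ofReal_measureReal]),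
    ofReal_inv_sqrt_gaussianEnergy hσ]
  have ha0 : c 0 / σ 0 < 0 := div_neg_of_neg_of_pos hc0 (hσ 0)
  have ha1 : 0 < c 1 / σ 1 := div_pos hc1 (hσ 1)
  have ha2 : 0 < c 2 / σ 2 := div_pos hc2 (hσ 2)
  gcongr
  exact le_lintegral_transport ha0 ha1 ha2 hD (fun j => (hT j).hasDerivAt)
    (fun j => (hT j).continuous_deriv) (hT 0).deriv_le_one (hTR 1 R hR1) (hTR 2 R hR2)
    fun p => pairSum_le_mul_prod_rpow ha0 ha1 ha2 hD (fun j => (hT j).deriv_pos _)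
      (fun j => (hT j).deriv_le_one _) h0 h1 h2

lemma tendsto_measure_Icc_neg (μ : Measure ℝ) :
    Tendsto (fun n : ℕ => μ (Icc (-(n : ℝ)) n)) atTop (𝓝 (μ univ)) := by
  have hmono : Monotone fun n : ℕ => Icc (-(n : ℝ)) n := fun m n h =>
    Icc_subset_Icc (neg_le_neg (Nat.cast_le.2 h)) (Nat.cast_le.2 h)
  have hU : ⋃ n : ℕ, Icc (-(n : ℝ)) n = univ := eq_univ_of_forall fun x => by
    obtain ⟨n, hn⟩ := exists_nat_ge |x|
    exact mem_iUnion.2 ⟨n, abs_le.1 hn⟩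
  rw [← hU]
  exact tendsto_measure_iUnion_atTop hmono

theorem le_functional (hc0 : c 0 < 0) (hc1 : 0 < c 1) (hc2 : 0 < c 2)
    (hσ : ∀ j, 0 < σ j) (hD : 0 < pairSum fun j => c j / σ j)
    (h0 : (1 - c 0) * (pairSum fun j => c j / σ j) = c 1 / σ 1 * (c 2 / σ 2))
    (h1 : c 0 / σ 0 * (c 2 / σ 2) ≤ (1 - c 1) * (pairSum fun j => c j / σ j))
    (h2 : c 0 / σ 0 * (c 1 / σ 1) ≤ (1 - c 2) * (pairSum fun j => c j / σ j))
    {f : Fin 3 → ℝ → ℝ≥0∞} (hf : ∀ j, f j ∈ typeClass (youngG σ j)) :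
    ENNReal.ofReal (√(gaussianEnergy c σ))⁻¹ ≤
      functional (E := fun _ : Fin 3 => ℝ) youngMap c f := by
  choose μ hμ hμ0 hfμ using hf
  obtain rfl : f = fun j => gaussianConv (youngG σ j) (μ j) := funext hfμ
  have hpos : ∀ j, μ j univ ≠ 0 := fun j => by simpa using hμ0 j
  have hpow : ∀ j, μ j univ ^ c j ≠ 0 ∧ μ j univ ^ c j ≠ ∞ := fun j => by
    simp [ENNReal.rpow_eq_zero_iff, ENNReal.rpow_eq_top_iff, hpos j, measure_ne_top]
  -- Only μ_1 and μ_2 are truncated. Their exponents are positive, so truncation decreases the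
  -- integrand; with c_0 < 0, cutting μ_0 would increase it.
  let S : ℕ → Fin 3 → Set ℝ := fun n => ![univ, Icc (-(n : ℝ)) n, Icc (-(n : ℝ)) n]
  have hSlim : ∀ j, Tendsto (fun n => μ j (S n j)) atTop (𝓝 (μ j univ)) := fun j => by
    fin_cases j
    · exact tendsto_const_nhds
    · exact tendsto_measure_Icc_neg _
    · exact tendsto_measure_Icc_neg _
  have hSpos : ∀ᶠ n in atTop, ∀ j, μ j (S n j) ≠ 0 :=
    eventually_all.2 fun j => (hSlim j).eventually_ne (hpos j)
  have hbound : ∀ᶠ n in atTop, ENNReal.ofReal (√(gaussianEnergy c σ))⁻¹ *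
      ∏ j, μ j (S n j) ^ c j ≤
      ∫⁻ p : ℝ × ℝ, ∏ j, gaussianConv (youngG σ j) (μ j) (youngMap j p) ^ c j := by
    filter_upwards [hSpos] with n hn
    have : ∀ j, NeZero ((μ j).restrict (S n j)) := fun j =>
      ⟨fun h => hn j (Measure.restrict_eq_zero.1 h)⟩
    have hb := le_functional_of_bounded_support hc0 hc1 hc2 hσ hD h0 h1 h2
      (fun j => (μ j).restrict (S n j)) (R := n)
      (by simp [S, Measure.restrict_apply measurableSet_Icc.compl])
      (by simp [S, Measure.restrict_apply measurableSet_Icc.compl])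
    unfold functional at hb
    simp_rw [lintegral_gaussianConv_youngG (hσ _), Measure.restrict_apply_univ] at hb
    have hb2 := ENNReal.mul_le_of_le_div hb
    refine hb2.trans (lintegral_mono fun p => ?_)
    simp only [Fin.prod_univ_three]
    have hle : ∀ j x, gaussianConv (youngG σ j) ((μ j).restrict (S n j)) x ≤
        gaussianConv (youngG σ j) (μ j) x := fun j x => setLIntegral_le_lintegral _ _
    have hr0 : (μ 0).restrict (S n 0) = μ 0 := Measure.restrict_univ
    rw [hr0]
    gcongr
    · exact hle 1 _
    · exact hle 2 _
  unfold functional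
  simp_rw [lintegral_gaussianConv_youngG (hσ _)]
  have hprod0 : ∏ j, μ j univ ^ c j ≠ 0 := Finset.prod_ne_zero_iff.2 fun j _ => (hpow j).1
  have hprodtop : ∏ j, μ j univ ^ c j ≠ ∞ := ENNReal.prod_ne_top fun j _ => (hpow j).2
  rw [ENNReal.le_div_iff_mul_le (Or.inl hprod0) (Or.inl hprodtop)]
  -- The integral on the right is independent of n, so only the masses of the truncations have to
  -- converge.
  refine le_of_tendsto (ENNReal.Tendsto.const_mul ?_ (Or.inl hprod0)) hbound
  have hlim : ∀ j, Tendsto (fun n => μ j (S n j) ^ c j) atTop (𝓝 (μ j univ ^ c j)) := fun j =>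
    ((ENNReal.continuous_rpow_const (y := c j)).tendsto _).comp (hSlim j)
  simp_rw [Fin.prod_univ_three]
  exact ENNReal.Tendsto.mul (ENNReal.Tendsto.mul (hlim 0) (Or.inr (hpow 1).2) (hlim 1)
    (Or.inr (hpow 0).2)) (Or.inr (hpow 2).2) (hlim 2)
    (Or.inr (ENNReal.mul_ne_top (hpow 0).2 (hpow 1).2))

end Sufficiency

/-! ### The two equivalences -/

section Main

variable {c σ : Fin 3 → ℝ}

lemma exists_functional_eq_gaussianEnergy (hc1 : 0 < c 1) (hc2 : 0 < c 2) (hσ : ∀ j, 0 < σ j)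
    (hD : 0 < pairSum fun j => c j / σ j) :
    ∃ f : Fin 3 → ℝ → ℝ≥0∞, (∀ j, f j ∈ typeClass (youngG σ j)) ∧
      functional (E := fun _ : Fin 3 => ℝ) youngMap c f =
        ENNReal.ofReal (√(gaussianEnergy c σ))⁻¹ :=
  ⟨_, fun j => normalDensity_mem_typeClass (hσ j) le_rfl,
    functional_normalDensity hσ (add_pos (div_pos hc1 (hσ 1)) (div_pos hc2 (hσ 2))) hD⟩

lemma ofReal_inv_sqrt_le_iff {x y : ℝ} (hx : 0 < x) (hy : 0 < y) :
    ENNReal.ofReal (√x)⁻¹ ≤ ENNReal.ofReal (√y)⁻¹ ↔ y ≤ x := by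
  rw [ENNReal.ofReal_le_ofReal_iff (by positivity),
    inv_le_inv₀ (Real.sqrt_pos.2 hx) (Real.sqrt_pos.2 hy), Real.sqrt_le_sqrt_iff hx.le]

/-- The supremum is always at least the constant, which is attained at variances σ_j. Equality is
thus an upper bound over the class: testing it on slightly larger variances gives necessity, and
transport gives sufficiency. -/
theorem youngForwardConst_eq_iff (hc : ∀ j, 0 < c j) (hσ : ∀ j, 0 < σ j)
    (hD : 0 < pairSum fun j => c j / σ j)
    (h0 : (1 - c 0) * (pairSum fun j => c j / σ j) = c 1 / σ 1 * (c 2 / σ 2)) :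
    youngForwardConst c σ = ENNReal.ofReal (√(gaussianEnergy c σ))⁻¹ ↔
      (1 - c 1) * (pairSum fun j => c j / σ j) ≤ c 0 / σ 0 * (c 2 / σ 2) ∧
      (1 - c 2) * (pairSum fun j => c j / σ j) ≤ c 0 / σ 0 * (c 1 / σ 1) := by
  have hE : 0 < gaussianEnergy c σ :=
    mul_pos (Finset.prod_pos fun j _ => Real.rpow_pos_of_pos (hσ j) _) hD
  constructor
  · intro h
    refine one_sub_mul_pairSum_le_of_energy_le hσ fun i => ?_
    filter_upwards [eventually_functional_update (hc 1) (hc 2) hσ hD i] with t ⟨ht, f, hf, hft⟩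
    rw [← ofReal_inv_sqrt_le_iff ht hE, ← h, ← hft]
    exact le_iSup₂_of_le f hf le_rfl
  · rintro ⟨h1, h2⟩
    obtain ⟨f, hf, hfe⟩ := exists_functional_eq_gaussianEnergy (hc 1) (hc 2) hσ hD
    refine le_antisymm (iSup₂_le fun g hg => functional_le hc hσ h0 h1 h2 hg) ?_
    rw [← hfe]
    exact le_iSup₂_of_le f hf le_rfl

theorem youngInverseConst_eq_iff (hc0 : c 0 < 0) (hc1 : 0 < c 1) (hc2 : 0 < c 2)
    (hσ : ∀ j, 0 < σ j) (hD : 0 < pairSum fun j => c j / σ j)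
    (h0 : (1 - c 0) * (pairSum fun j => c j / σ j) = c 1 / σ 1 * (c 2 / σ 2)) :
    youngInverseConst c σ = ENNReal.ofReal (√(gaussianEnergy c σ))⁻¹ ↔
      c 0 / σ 0 * (c 2 / σ 2) ≤ (1 - c 1) * (pairSum fun j => c j / σ j) ∧
      c 0 / σ 0 * (c 1 / σ 1) ≤ (1 - c 2) * (pairSum fun j => c j / σ j) := by
  have hE : 0 < gaussianEnergy c σ :=
    mul_pos (Finset.prod_pos fun j _ => Real.rpow_pos_of_pos (hσ j) _) hD
  constructor
  · intro h
    refine le_one_sub_mul_pairSum_of_le_energy hσ fun i => ?_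
    filter_upwards [eventually_functional_update hc1 hc2 hσ hD i] with t ⟨ht, f, hf, hft⟩
    rw [← ofReal_inv_sqrt_le_iff hE ht, ← h, ← hft]
    exact iInf₂_le_of_le f hf le_rfl
  · rintro ⟨h1, h2⟩
    obtain ⟨f, hf, hfe⟩ := exists_functional_eq_gaussianEnergy hc1 hc2 hσ hD
    refine le_antisymm ?_ (le_iInf₂ fun g hg => le_functional hc0 hc1 hc2 hσ hD h0 h1 h2 hg)
    rw [← hfe]
    exact iInf₂_le_of_le f hf le_rfl

end Main

end BrascampLieb

theorem corollaryp (c σ : Fin 3 → ℝ)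
    (hc0 : c 0 < 1) (hc1 : 0 < c 1) (hc2 : 0 < c 2) (hσ : ∀ j, 0 < σ j)
    (hcσ : σ 0 / (1 - c 0) = σ 1 / c 1 + σ 2 / c 2) :
    ((∀ j, 0 < c j ∧ c j < 1) →
      (BrascampLieb.youngForwardConst c σ =
          ENNReal.ofReal (BrascampLieb.tildeA (c 1) (σ 1) * BrascampLieb.tildeA (c 2) (σ 2) /
            BrascampLieb.tildeA (1 - c 0) (σ 0)) ↔
        c 0 * (1 - c 0) / σ 0 ≥
          max (c 1 * (1 - c 1) / σ 1) (c 2 * (1 - c 2) / σ 2))) ∧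
    ((c 0 < 0 ∧ 1 ≤ c 1 ∧ 1 ≤ c 2) →
      (BrascampLieb.youngInverseConst c σ =
          ENNReal.ofReal (BrascampLieb.tildeA (c 1) (σ 1) * BrascampLieb.tildeA (c 2) (σ 2) /
            BrascampLieb.tildeA (1 - c 0) (σ 0)) ↔
        c 0 * (1 - c 0) / σ 0 ≤
          min (c 1 * (1 - c 1) / σ 1) (c 2 * (1 - c 2) / σ 2))) := by
  have hD := BrascampLieb.pairSum_div_pos hc0 hc1 hc2 hσ hcσ
  have h0 := BrascampLieb.one_sub_mul_pairSum hc0 hc1 hc2 hσ hcσ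
  obtain ⟨⟨i1, i2⟩, i3, i4⟩ := BrascampLieb.le_iff_one_sub_mul_pairSum_le
    (a := fun j => c j / σ j) (div_pos hc1 (hσ 1)) (div_pos hc2 (hσ 2)) hD h0
  have e : ∀ j, c j * (1 - c j) / σ j = (1 - c j) * (c j / σ j) := fun j => by ring
  rw [BrascampLieb.tildeA_mul_div_eq hc0 hc1 hc2 hσ hcσ]
  simp only [ge_iff_le, max_le_iff, le_min_iff, e]
  refine ⟨fun hc => ?_, fun hc => ?_⟩
  · rw [BrascampLieb.youngForwardConst_eq_iff (fun j => (hc j).1) hσ hD h0]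
    exact (and_congr i1 i2).symm
  · rw [BrascampLieb.youngInverseConst_eq_iff hc.1 hc1 hc2 hσ hD h0]
    exact (and_congr i3 i4).symm
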